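/- Let $n>1$ and $N>1$ be integers, let $a_k>0$ and $\beta_k,d_k\in\mathbb R$ ($k=1,\dots,N$) satisfy $\sum_{k=1}^N a_k=1$ and $\sum_{k=1}^N a_k|d_k|^2<1$, and put $\alpha_0=0$, $\alpha_k=\alpha_{k-1}+a_k$. Assume that exactly one of the numbers $d_1,\dots,d_N$, namely $d_m$, is different from zero and that at least one $\beta_k$ is different from zero. Let $P\in L_2[0,1]$ be the self-similar function with these parameters, that is, the solution of $$P(x)=\beta_k+d_k\,P\!\left(\frac{x-\alpha_{k-1}}{a_k}\right)\quad\text{for a.e. }x\in(\alpha_{k-1},\alpha_k),\qquad k=1,\dots,N,$$ and assume that $P$ is not piecewise constant with finitely many discontinuities (so that $P$ is a self-similar function of zero spectral order). Let $\rho=P'$ be its generalized derivative. Consider the boundary value problem $$(-1)^n y^{(2n)}-\lambda\rho y=0,\qquad y^{(k)}(0)=y^{(k)}(1)=0,\quad 0\le k<n,$$ understood as follows: $\lambda$ is an eigenvalue if there is a nonzero function $y$ in the complex Sobolev space $\mathring W_2^n[0,1]$ such that $$\int_0^1\left(y^{(n)}\,\overline{z^{(n)}}+\lambda P\cdot(y\overline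 z)'\right)dx=0\qquad\text{for all }z\in\mathring W_2^n[0,1],$$ and its multiplicity is the dimension of the space of all such $y$ (together with $0$). For $k=1,\dots,N-1$ put $$\zeta_k=\begin{cases}\beta_m-\beta_{m-1}+d_m\beta_1,&k=m-1,\\ \beta_{m+1}-\beta_m-d_m\beta_N,&k=m,\\ \beta_{k+1}-\beta_k,&\text{otherwise,}\end{cases}$$ and let $Z_\pm$ be the number of $k\in\{1,\dots,N-1\}$ with $\pm\zeta_k>0$. Suppose that $d_m>0$, $Z_+>0$ and $Z_++Z_-=N-1$. Then the positive eigenvalues of the problem, numbered in increasing order and counted with their (finite) multiplicities, form an infinite sequence $\{\lambda_k\}_{k=1}^\infty$, and there are real numbers $\tau_l>0$, $l=1,\dots,Z_+$, such that for every such $l$ $$\lambda_{l+kZ_+}=\tau_l\,(a_m^{2n-1}d_m)^{-k}\,(1+o(1))\qquad\text{as }k\to\infty.$$ -/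

import Mathlib

open MeasureTheory Set Filter Topology Asymptotics
open scoped ComplexConjugate

noncomputable section

namespace SelfSimilarWeight

/-- Lebesgue measure on the unit interval. -/
abbrev unitMeasure : Measure ℝ := volume.restrict (Icc (0 : ℝ) 1)

/-! ### Self-similar functions

The parameters `a k`, `β k`, `d k` are used for `k = 1, …, N` only. -/

/-- The partition points: `α₀ = 0` and `αₖ = αₖ₋₁ + aₖ`. -/
def knot (a : ℕ → ℝ) (k : ℕ) : ℝ := ∑ i ∈ Finset.Icc 1 k, a i

/-- The similarity operator: on the interval `(αₖ₋₁, αₖ)`, `k = 1, …, N`, the function `G f` is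
`x ↦ βₖ + dₖ f ((x - αₖ₋₁) / aₖ)`. -/
def similarityOp (N : ℕ) (a β d : ℕ → ℝ) (f : ℝ → ℝ) (x : ℝ) : ℝ :=
  ∑ k ∈ Finset.Icc 1 N, (Ioo (knot a (k - 1)) (knot a k)).indicator
    (fun t => β k + d k * f ((t - knot a (k - 1)) / a k)) x

/-- `P ∈ L₂[0,1]` is (affinely) self-similar with self-similarity parameters `a`, `β`, `d`: it is a
fixed point, in `L₂[0,1]`, of the corresponding contractive similarity operator. -/
structure IsSelfSimilar (N : ℕ) (a β d : ℕ → ℝ) (P : ℝ → ℝ) : Prop where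
  one_lt : 1 < N
  pos : ∀ k ∈ Finset.Icc 1 N, 0 < a k
  sum_eq_one : ∑ k ∈ Finset.Icc 1 N, a k = 1
  contractive : ∑ k ∈ Finset.Icc 1 N, a k * |d k| ^ 2 < 1
  memLp : MemLp P 2 unitMeasure
  fixed : similarityOp N a β d P =ᵐ[unitMeasure] P

/-- `P` is (up to a null set) piecewise constant on `[0,1]` with finitely many discontinuities. -/
def IsPiecewiseConstant (P : ℝ → ℝ) : Prop :=
  ∃ F : Finset ℝ, ∀ u v : ℝ, 0 ≤ u → u < v → v ≤ 1 → (∀ t ∈ Ioo u v, t ∉ F) →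
    ∃ c : ℝ, P =ᵐ[volume.restrict (Ioo u v)] fun _ => c

/-- `P` is a self-similar function of zero spectral order, and `m` is the index of the only
nonzero number among `d₁, …, d_N`. -/
structure IsZeroSpectralOrder (N m : ℕ) (a β d : ℕ → ℝ) (P : ℝ → ℝ) : Prop
    extends IsSelfSimilar N a β d P where
  nontrivial : ¬ IsPiecewiseConstant P
  exists_beta_ne_zero : ∃ k ∈ Finset.Icc 1 N, β k ≠ 0
  mem : m ∈ Finset.Icc 1 N
  ne_zero_iff : ∀ k ∈ Finset.Icc 1 N, d k ≠ 0 ↔ k = m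

/-- The numbers `ζₖ`, `k = 1, …, N - 1`. -/
def zeta (N m : ℕ) (β d : ℕ → ℝ) (k : ℕ) : ℝ :=
  if k + 1 = m then β m - β (m - 1) + d m * β 1
  else if k = m then β (m + 1) - β m - d m * β N
  else β (k + 1) - β k

/-- `Z₊`, the number of `k ∈ [1, N - 1]` with `ζₖ > 0`. -/
def zPlus (N m : ℕ) (β d : ℕ → ℝ) : ℕ :=
  ((Finset.Icc 1 (N - 1)).filter fun k => 0 < zeta N m β d k).card

/-- `Z₋`, the number of `k ∈ [1, N - 1]` with `ζₖ < 0`. -/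
def zMinus (N m : ℕ) (β d : ℕ → ℝ) : ℕ :=
  ((Finset.Icc 1 (N - 1)).filter fun k => zeta N m β d k < 0).card

/-! ### The Sobolev space and the operator pencil -/

theorem intervalIntegrable_of_memLp {g : ℝ → ℂ} (hg : MemLp g 2 unitMeasure) {x : ℝ}
    (hx : x ∈ Icc (0 : ℝ) 1) : IntervalIntegrable g volume 0 x := by
  rw [intervalIntegrable_iff_integrableOn_Icc_of_le hx.1]
  exact (hg.integrable (by norm_num)).mono_measure
    (Measure.restrict_mono (Icc_subset_Icc_right hx.2) le_rfl)

/-- The Sobolev space `W̊₂ⁿ[0,1]` (`n ≥ 1`) of complex functions with `y⁽ᵏ⁾(0) = y⁽ᵏ⁾(1) = 0` for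
`k < n`. Its elements are represented by their continuous representatives, extended by zero to `ℝ`;
the boundary conditions say exactly that this extension is of class `Cⁿ⁻¹` on `ℝ`. The last
condition says that `y⁽ⁿ⁻¹⁾` is absolutely continuous on `[0,1]` with derivative in `L₂[0,1]`. -/
def dirichletSobolev (n : ℕ) : Submodule ℂ (ℝ → ℂ) where
  carrier := {y | (∀ x ∉ Ioo (0 : ℝ) 1, y x = 0) ∧ ContDiff ℝ (n - 1 : ℕ) y ∧
    ∃ g : ℝ → ℂ, MemLp g 2 unitMeasure ∧
      ∀ x ∈ Icc (0 : ℝ) 1, iteratedDeriv (n - 1) y x = ∫ t in (0 : ℝ)..x, g t}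
  zero_mem' := by
    refine ⟨fun _ _ => rfl, contDiff_const, 0, MemLp.zero, fun x _ => ?_⟩
    simp
  add_mem' := by
    rintro y z ⟨hy0, hyc, g, hg, hyg⟩ ⟨hz0, hzc, f, hf, hzf⟩
    refine ⟨fun x hx => by simp [hy0 x hx, hz0 x hx], hyc.add hzc, g + f, hg.add hf, fun x hx => ?_⟩
    rw [iteratedDeriv_add hyc.contDiffAt hzc.contDiffAt, hyg x hx, hzf x hx]
    exact (intervalIntegral.integral_add (intervalIntegrable_of_memLp hg hx)
      (intervalIntegrable_of_memLp hf hx)).symm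
  smul_mem' := by
    rintro c y ⟨hy0, hyc, g, hg, hyg⟩
    refine ⟨fun x hx => by simp [hy0 x hx], hyc.const_smul c, c • g, hg.const_smul c,
      fun x hx => ?_⟩
    rw [iteratedDeriv_const_smul hyc.contDiffAt, hyg x hx]
    exact (intervalIntegral.integral_smul c g).symm

/-- The sesquilinear form of the pencil `T_ρ(lam)` with `ρ = P'`, that is,
`∫₀¹ (y⁽ⁿ⁾ conj(z⁽ⁿ⁾) + lam P (y conj z)') dx`. For `y`, `z` in `W̊₂ⁿ[0,1]` the derivative `y⁽ⁿ⁾`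
exists almost everywhere on `[0,1]` and coincides there with the weak derivative. -/
def pencilForm (n : ℕ) (P : ℝ → ℝ) (lam : ℂ) (y z : ℝ → ℂ) : ℂ :=
  ∫ x in (0 : ℝ)..1, (iteratedDeriv n y x * conj (iteratedDeriv n z x) +
    lam * (P x * deriv (fun t => y t * conj (z t)) x))

/-! The following facts are needed only to see that the eigenfunctions form a linear subspace. -/

theorem ae_hasDerivAt {n : ℕ} (hn : 1 < n) {y : ℝ → ℂ} (hy : y ∈ dirichletSobolev n) :
    (∀ᵐ x ∂unitMeasure, HasDerivAt (iteratedDeriv (n - 1) y) (iteratedDeriv n y x) x) ∧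
      MemLp (iteratedDeriv n y) 2 unitMeasure := by
  obtain ⟨-, -, g, hg, hyg⟩ := hy
  have h1 : ∀ᵐ x ∂unitMeasure, HasDerivAt (iteratedDeriv (n - 1) y) (g x) x := by
    have h := (intervalIntegrable_of_memLp hg
      (right_mem_Icc.2 zero_le_one)).ae_hasDerivAt_integral
    have h' : unitMeasure = volume.restrict (Ioo (0 : ℝ) 1) := (restrict_Ioo_eq_restrict_Icc).symm
    rw [h', ae_restrict_iff' measurableSet_Ioo]
    filter_upwards [h] with x hx hx01
    have hx' : x ∈ uIcc (0 : ℝ) 1 := by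
      rw [uIcc_of_le zero_le_one]; exact Ioo_subset_Icc_self hx01
    refine (hx hx' 0 (by simp)).congr_of_eventuallyEq ?_
    filter_upwards [isOpen_Ioo.mem_nhds hx01] with t ht
    exact hyg t (Ioo_subset_Icc_self ht)
  have h2 : ∀ x, iteratedDeriv n y x = deriv (iteratedDeriv (n - 1) y) x := by
    intro x
    obtain ⟨m, rfl⟩ : ∃ m, n = m + 1 := ⟨n - 1, by omega⟩
    rw [iteratedDeriv_succ, Nat.add_sub_cancel]
  refine ⟨?_, hg.ae_eq ?_⟩
  · filter_upwards [h1] with x hx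
    rw [h2, hx.deriv]; exact hx
  · filter_upwards [h1] with x hx
    rw [h2, hx.deriv]

theorem contDiff_one {n : ℕ} (hn : 1 < n) {y : ℝ → ℂ} (hy : y ∈ dirichletSobolev n) :
    ContDiff ℝ 1 y :=
  hy.2.1.of_le (by exact_mod_cast (by omega : 1 ≤ n - 1))

theorem contDiff_mul_conj {n : ℕ} (hn : 1 < n) {y z : ℝ → ℂ} (hy : y ∈ dirichletSobolev n)
    (hz : z ∈ dirichletSobolev n) : ContDiff ℝ 1 (fun t => y t * conj (z t)) :=
  (contDiff_one hn hy).mul (Complex.conjCLE.contDiff.comp (contDiff_one hn hz))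

theorem integrable_pencil {n : ℕ} (hn : 1 < n) {P : ℝ → ℝ} (hP : MemLp P 2 unitMeasure) (lam : ℂ)
    {y z : ℝ → ℂ} (hy : y ∈ dirichletSobolev n) (hz : z ∈ dirichletSobolev n) :
    IntervalIntegrable (fun x => iteratedDeriv n y x * conj (iteratedDeriv n z x) +
      lam * (P x * deriv (fun t => y t * conj (z t)) x)) volume 0 1 := by
  rw [intervalIntegrable_iff_integrableOn_Icc_of_le zero_le_one]
  refine Integrable.add ?_ (Integrable.const_mul ?_ lam)
  · exact (ae_hasDerivAt hn hy).2.integrable_mul (ae_hasDerivAt hn hz).2.star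
  · have hc : Continuous (deriv (fun t => y t * conj (z t))) :=
      (contDiff_mul_conj hn hy hz).continuous_deriv le_rfl
    have hb : MemLp (deriv (fun t => y t * conj (z t))) 2 unitMeasure := by
      obtain ⟨C, hC⟩ := (isCompact_Icc (a := (0 : ℝ)) (b := 1)).exists_bound_of_continuousOn
        hc.continuousOn
      exact MemLp.of_bound hc.aestronglyMeasurable C
        ((ae_restrict_iff' measurableSet_Icc).2 (Eventually.of_forall hC))
    exact (hP.ofReal (K := ℂ)).integrable_mul hb

theorem pencilForm_add {n : ℕ} (hn : 1 < n) {P : ℝ → ℝ} (hP : MemLp P 2 unitMeasure) (lam : ℂ)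
    {y₁ y₂ z : ℝ → ℂ} (h₁ : y₁ ∈ dirichletSobolev n) (h₂ : y₂ ∈ dirichletSobolev n)
    (hz : z ∈ dirichletSobolev n) :
    pencilForm n P lam (y₁ + y₂) z = pencilForm n P lam y₁ z + pencilForm n P lam y₂ z := by
  unfold pencilForm
  rw [← intervalIntegral.integral_add (integrable_pencil hn hP lam h₁ hz)
    (integrable_pencil hn hP lam h₂ hz), intervalIntegral.integral_of_le zero_le_one,
    intervalIntegral.integral_of_le zero_le_one, restrict_Ioc_eq_restrict_Icc]
  refine integral_congr_ae ?_
  filter_upwards [(ae_hasDerivAt hn h₁).1, (ae_hasDerivAt hn h₂).1,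
    (ae_hasDerivAt hn (add_mem h₁ h₂)).1] with x hx₁ hx₂ hx
  have e1 : iteratedDeriv n (y₁ + y₂) x = iteratedDeriv n y₁ x + iteratedDeriv n y₂ x := by
    refine hx.unique ?_
    have e : iteratedDeriv (n - 1) (y₁ + y₂) =
        iteratedDeriv (n - 1) y₁ + iteratedDeriv (n - 1) y₂ := by
      funext t
      exact iteratedDeriv_add h₁.2.1.contDiffAt h₂.2.1.contDiffAt
    rw [e]
    exact hx₁.add hx₂
  have e2 : deriv (fun t => (y₁ + y₂) t * conj (z t)) x =
      deriv (fun t => y₁ t * conj (z t)) x + deriv (fun t => y₂ t * conj (z t)) x := by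
    rw [← deriv_fun_add ((contDiff_mul_conj hn h₁ hz).differentiable one_ne_zero x)
      ((contDiff_mul_conj hn h₂ hz).differentiable one_ne_zero x)]
    congr 1
    funext t
    simp [add_mul]
  rw [e1, e2]
  ring

theorem pencilForm_smul {n : ℕ} (hn : 1 < n) (P : ℝ → ℝ) (lam c : ℂ)
    {y z : ℝ → ℂ} (hy : y ∈ dirichletSobolev n) (hz : z ∈ dirichletSobolev n) :
    pencilForm n P lam (c • y) z = c * pencilForm n P lam y z := by
  unfold pencilForm
  rw [← intervalIntegral.integral_const_mul, intervalIntegral.integral_of_le zero_le_one,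
    intervalIntegral.integral_of_le zero_le_one, restrict_Ioc_eq_restrict_Icc]
  refine integral_congr_ae ?_
  filter_upwards [(ae_hasDerivAt hn hy).1,
    (ae_hasDerivAt hn (Submodule.smul_mem _ c hy)).1] with x hx₁ hx
  have e1 : iteratedDeriv n (c • y) x = c * iteratedDeriv n y x := by
    refine hx.unique ?_
    have e : iteratedDeriv (n - 1) (c • y) = c • iteratedDeriv (n - 1) y := by
      funext t
      exact iteratedDeriv_const_smul hy.2.1.contDiffAt c
    rw [e]
    exact hx₁.const_smul c
  have e2 : deriv (fun t => (c • y) t * conj (z t)) x =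
      c * deriv (fun t => y t * conj (z t)) x := by
    rw [← deriv_const_mul c ((contDiff_mul_conj hn hy hz).differentiable one_ne_zero x)]
    congr 1
    funext t
    simp [mul_assoc]
  rw [e1, e2]
  ring

/-! ### Eigenvalues -/

/-- The space of solutions `y ∈ W̊₂ⁿ[0,1]` of `(-1)ⁿ y⁽²ⁿ⁾ - lam ρ y = 0`, where `ρ = P'`, that is,
the kernel of `T_ρ(lam)`. -/
def eigenspace (n : ℕ) (hn : 1 < n) (P : ℝ → ℝ) (hP : MemLp P 2 unitMeasure) (lam : ℂ) :
    Submodule ℂ (ℝ → ℂ) where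
  carrier := {y | y ∈ dirichletSobolev n ∧
    ∀ z ∈ dirichletSobolev n, pencilForm n P lam y z = 0}
  zero_mem' := by
    refine ⟨zero_mem _, fun z hz => ?_⟩
    have h := pencilForm_smul hn P lam 0 (zero_mem (dirichletSobolev n)) hz
    simpa using h
  add_mem' := by
    rintro y₁ y₂ ⟨h₁, e₁⟩ ⟨h₂, e₂⟩
    refine ⟨add_mem h₁ h₂, fun z hz => ?_⟩
    rw [pencilForm_add hn hP lam h₁ h₂ hz, e₁ z hz, e₂ z hz, add_zero]
  smul_mem' := by
    rintro c y ⟨hy, e⟩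
    refine ⟨Submodule.smul_mem _ c hy, fun z hz => ?_⟩
    rw [pencilForm_smul hn P lam c hy hz, e z hz, mul_zero]

/-- `lam 1 ≤ lam 2 ≤ …` is the infinite sequence of all positive eigenvalues, numbered in increasing
order and counted with (finite) multiplicity. The value `lam 0` plays no role. -/
structure IsPositiveEigenvalueSequence (n : ℕ) (hn : 1 < n) (P : ℝ → ℝ)
    (hP : MemLp P 2 unitMeasure) (lam : ℕ → ℝ) : Prop where
  pos : ∀ k, 1 ≤ k → 0 < lam k
  mono : ∀ j k, 1 ≤ j → j ≤ k → lam j ≤ lam k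
  finite_multiplicity : ∀ μ : ℝ, 0 < μ → FiniteDimensional ℂ (eigenspace n hn P hP μ)
  finite_index : ∀ μ : ℝ, 0 < μ → {k : ℕ | 1 ≤ k ∧ lam k = μ}.Finite
  multiplicity : ∀ μ : ℝ, 0 < μ →
    {k : ℕ | 1 ≤ k ∧ lam k = μ}.ncard = Module.finrank ℂ (eigenspace n hn P hP μ)

end SelfSimilarWeight

end

noncomputable section

namespace SelfSimilarWeight

section SpectralTheory

open Module.End
open scoped InnerProductSpace

variable {H : Type*} [NormedAddCommGroup H] [InnerProductSpace ℂ H]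

/-- The algebraic span of the eigenspaces of `T` for the eigenvalues `μ⁻¹`, `μ ∈ s`. -/
def spectralSpan (T : H →L[ℂ] H) (s : Set ℝ) : Submodule ℂ H :=
  ⨆ μ ∈ s, Module.End.eigenspace (T : H →ₗ[ℂ] H) ((μ : ℂ)⁻¹)

theorem spectralSpan_mono (T : H →L[ℂ] H) {s t : Set ℝ} (h : s ⊆ t) :
    spectralSpan T s ≤ spectralSpan T t :=
  biSup_mono fun _ hμ => h hμ

theorem spectralSpan_union (T : H →L[ℂ] H) (s t : Set ℝ) :
    spectralSpan T (s ∪ t) = spectralSpan T s ⊔ spectralSpan T t :=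
  iSup_union

theorem spectralSpan_singleton (T : H →L[ℂ] H) (μ : ℝ) :
    spectralSpan T {μ} = Module.End.eigenspace (T : H →ₗ[ℂ] H) ((μ : ℂ)⁻¹) := by
  simp [spectralSpan]

variable {T : H →L[ℂ] H}

theorem inner_eigenspace_eq_zero (hT : (T : H →ₗ[ℂ] H).IsSymmetric) {μ ν : ℝ} (hμν : μ ≠ ν)
    {v w : H} (hv : v ∈ Module.End.eigenspace (T : H →ₗ[ℂ] H) ((μ : ℂ)⁻¹))
    (hw : w ∈ Module.End.eigenspace (T : H →ₗ[ℂ] H) ((ν : ℂ)⁻¹)) : ⟪v, w⟫_ℂ = 0 :=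
  Submodule.isOrtho_iff_inner_eq.1 (hT.orthogonalFamily_eigenspaces.isOrtho
    fun h => hμν (Complex.ofReal_injective (inv_injective h))) v hv w hw

theorem spectralSpan_isOrtho (hT : (T : H →ₗ[ℂ] H).IsSymmetric) {s t : Set ℝ}
    (h : Disjoint s t) : spectralSpan T s ⟂ spectralSpan T t := by
  simp only [spectralSpan, Submodule.isOrtho_iSup_left, Submodule.isOrtho_iSup_right]
  intro μ hμ ν hν
  rw [Submodule.isOrtho_iff_inner_eq]
  intro v hv w hw
  exact inner_eigenspace_eq_zero hT (h.ne_of_mem hν hμ) hv hw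

theorem exists_sum_of_mem_spectralSpan {s : Set ℝ} {y : H} (hy : y ∈ spectralSpan T s) :
    ∃ (F : Finset ℝ) (v : ℝ → H), (∀ μ ∈ F, μ ∈ s) ∧
      (∀ μ : ℝ, v μ ∈ Module.End.eigenspace (T : H →ₗ[ℂ] H) ((μ : ℂ)⁻¹)) ∧ ∑ μ ∈ F, v μ = y := by
  classical
  rw [spectralSpan, iSup_subtype', Submodule.mem_iSup_iff_exists_finsupp] at hy
  obtain ⟨f, hf, rfl⟩ := hy
  refine ⟨f.support.map (Function.Embedding.subtype _),
    fun μ => if h : μ ∈ s then f ⟨μ, h⟩ else 0, ?_, fun μ => ?_, ?_⟩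
  · intro μ hμ
    obtain ⟨a, -, rfl⟩ := Finset.mem_map.1 hμ
    exact a.2
  · dsimp only
    split_ifs with h
    · exact hf ⟨μ, h⟩
    · exact zero_mem _
  · rw [Finset.sum_map, Finsupp.sum]
    exact Finset.sum_congr rfl fun a _ => by simp

theorem norm_sq_sum_eigenvectors (hT : (T : H →ₗ[ℂ] H).IsSymmetric) (F : Finset ℝ) {v : ℝ → H}
    (hv : ∀ μ : ℝ, v μ ∈ Module.End.eigenspace (T : H →ₗ[ℂ] H) ((μ : ℂ)⁻¹)) :
    ‖∑ μ ∈ F, v μ‖ ^ 2 = ∑ μ ∈ F, ‖v μ‖ ^ 2 := by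
  have h : ⟪∑ μ ∈ F, v μ, ∑ μ ∈ F, v μ⟫_ℂ = ∑ μ ∈ F, ⟪v μ, v μ⟫_ℂ := by
    rw [sum_inner]
    refine Finset.sum_congr rfl fun μ hμ => ?_
    rw [inner_sum]
    refine Finset.sum_eq_single_of_mem μ hμ fun ν _ hν => ?_
    exact inner_eigenspace_eq_zero hT hν.symm (hv μ) (hv ν)
  simp only [inner_self_eq_norm_sq_to_K] at h
  exact_mod_cast h

theorem re_inner_sum_eigenvectors (hT : (T : H →ₗ[ℂ] H).IsSymmetric) (F : Finset ℝ) {v : ℝ → H}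
    (hv : ∀ μ : ℝ, v μ ∈ Module.End.eigenspace (T : H →ₗ[ℂ] H) ((μ : ℂ)⁻¹)) :
    (⟪T (∑ μ ∈ F, v μ), ∑ μ ∈ F, v μ⟫_ℂ).re = ∑ μ ∈ F, μ⁻¹ * ‖v μ‖ ^ 2 := by
  have hTv : ∀ μ : ℝ, T (v μ) = (μ : ℂ)⁻¹ • v μ := fun μ => mem_eigenspace_iff.1 (hv μ)
  have h : ⟪T (∑ μ ∈ F, v μ), ∑ μ ∈ F, v μ⟫_ℂ = ∑ μ ∈ F, ((μ⁻¹ * ‖v μ‖ ^ 2 : ℝ) : ℂ) := by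
    rw [map_sum, sum_inner]
    refine Finset.sum_congr rfl fun μ hμ => ?_
    rw [inner_sum, Finset.sum_eq_single_of_mem μ hμ fun ν _ hν => ?_]
    · rw [hTv, inner_smul_left, inner_self_eq_norm_sq_to_K]
      simp
    · rw [hTv, inner_smul_left, inner_eigenspace_eq_zero hT hν.symm (hv μ) (hv ν), mul_zero]
  rw [h, Complex.re_sum]
  simp only [Complex.ofReal_re]

theorem le_re_inner_of_mem_spectralSpan (hT : (T : H →ₗ[ℂ] H).IsSymmetric) {s : Set ℝ} {c : ℝ}
    (hs : ∀ μ ∈ s, c ≤ μ⁻¹) {y : H} (hy : y ∈ spectralSpan T s) :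
    c * ‖y‖ ^ 2 ≤ (⟪T y, y⟫_ℂ).re := by
  obtain ⟨F, v, hF, hv, rfl⟩ := exists_sum_of_mem_spectralSpan hy
  rw [re_inner_sum_eigenvectors hT F hv, norm_sq_sum_eigenvectors hT F hv, Finset.mul_sum]
  exact Finset.sum_le_sum fun μ hμ => by gcongr; exact hs μ (hF μ hμ)

theorem re_inner_le_of_mem_spectralSpan (hT : (T : H →ₗ[ℂ] H).IsSymmetric) {s : Set ℝ} {c : ℝ}
    (hs : ∀ μ ∈ s, μ⁻¹ ≤ c) {y : H} (hy : y ∈ spectralSpan T s) :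
    (⟪T y, y⟫_ℂ).re ≤ c * ‖y‖ ^ 2 := by
  obtain ⟨F, v, hF, hv, rfl⟩ := exists_sum_of_mem_spectralSpan hy
  rw [re_inner_sum_eigenvectors hT F hv, norm_sq_sum_eigenvectors hT F hv, Finset.mul_sum]
  exact Finset.sum_le_sum fun μ hμ => by gcongr; exact hs μ (hF μ hμ)

/-- A symmetric operator whose quadratic form is arbitrarily small on closed subspaces of finite
codimension is compact. -/
theorem isCompactOperator_of_small [CompleteSpace H] (hT : (T : H →ₗ[ℂ] H).IsSymmetric)
    (h : ∀ ε > 0, ∃ (r : ℕ) (L : H →L[ℂ] (Fin r → ℂ)),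
      ∀ y, L y = 0 → |(⟪T y, y⟫_ℂ).re| ≤ ε * ‖y‖ ^ 2) : IsCompactOperator T := by
  suffices hcl : T ∈ closure {S : H →L[ℂ] H | IsCompactOperator S} by
    rwa [isClosed_setOfPred_isCompactOperator.closure_eq] at hcl
  rw [Metric.mem_closure_iff]
  intro ε hε
  obtain ⟨r, L, hL⟩ := h (ε / 2) (half_pos hε)
  let M : Submodule ℂ H := L.ker
  have hMc : IsClosed (M : Set H) := L.isClosed_ker
  have : CompleteSpace M := hMc.completeSpace_coe
  have hfin : FiniteDimensional ℂ Mᗮ := by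
    refine FiniteDimensional.of_injective ((L : H →ₗ[ℂ] (Fin r → ℂ)).comp Mᗮ.subtype) ?_
    rw [← LinearMap.ker_eq_bot, LinearMap.ker_eq_bot']
    rintro ⟨y, hy⟩ h0
    have hyM : y ∈ M := h0
    simpa using Submodule.inner_right_of_mem_orthogonal hyM hy
  have hq : IsCompactOperator (Mᗮ.starProjection : H →L[ℂ] H) := by
    have := FiniteDimensional.proper ℂ Mᗮ
    have h1 : IsCompactOperator (Mᗮ.orthogonalProjectionOnto : H →L[ℂ] Mᗮ) :=
      isCompactOperator_of_locallyCompactSpace_dom (Mᗮ.orthogonalProjectionOnto : H →L[ℂ] Mᗮ)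
    exact h1.clm_comp Mᗮ.subtypeL
  set p : H →L[ℂ] H := M.starProjection
  set q : H →L[ℂ] H := Mᗮ.starProjection
  have hpq : ∀ y, y = p y + q y := fun y =>
    (Submodule.starProjection_add_starProjection_orthogonal y).symm
  refine ⟨T - p ∘L T ∘L p, ?_, ?_⟩
  · have e : T - p ∘L T ∘L p = q ∘L T + p ∘L T ∘L q := by
      ext y
      have h1 := hpq (T y)
      have h2 : T y = T (p y) + T (q y) := by rw [← map_add, ← hpq y]
      simp only [_root_.sub_apply, _root_.add_apply,
        ContinuousLinearMap.comp_apply]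
      nth_rewrite 1 [h1]
      nth_rewrite 1 [h2]
      rw [map_add]
      abel
    change IsCompactOperator (T - p ∘L T ∘L p)
    rw [e]
    exact (hq.comp_clm T).add ((hq.clm_comp T).clm_comp p)
  · rw [dist_eq_norm, sub_sub_cancel]
    have hps : ∀ x y, ⟪p x, y⟫_ℂ = ⟪x, p y⟫_ℂ := fun x y =>
      Submodule.inner_starProjection_left_eq_right M x y
    have hsym : ((p ∘L T ∘L p : H →L[ℂ] H) : H →ₗ[ℂ] H).IsSymmetric := by
      intro x y
      change ⟪p (T (p x)), y⟫_ℂ = ⟪x, p (T (p y))⟫_ℂ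
      rw [hps, ← hps x]
      exact hT (p x) (p y)
    rw [ContinuousLinearMap.norm_eq_iSup_rayleighQuotient _ hsym]
    refine lt_of_le_of_lt (ciSup_le fun x => ?_) (half_lt_self hε)
    have hx : L (p x) = 0 := M.starProjection_apply_mem x
    have h1 := hL _ hx
    have h2 : ‖p x‖ ≤ ‖x‖ := M.norm_starProjection_apply_le x
    have h3 : (p ∘L T ∘L p).reApplyInnerSelf x = (⟪T (p x), p x⟫_ℂ).re := by
      rw [ContinuousLinearMap.reApplyInnerSelf_apply]
      change (⟪p (T (p x)), x⟫_ℂ).re = _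
      rw [hps]
    rw [ContinuousLinearMap.rayleighQuotient, h3, abs_div, abs_of_nonneg (sq_nonneg ‖x‖)]
    refine div_le_of_le_mul₀ (by positivity) (by positivity) (h1.trans ?_)
    gcongr

theorem eigenspace_le_spectralSpan_univ (hT : (T : H →ₗ[ℂ] H).IsSymmetric) (ν : ℂ) :
    Module.End.eigenspace (T : H →ₗ[ℂ] H) ν ≤ spectralSpan T univ := by
  by_cases h : Module.End.eigenspace (T : H →ₗ[ℂ] H) ν = ⊥
  · rw [h]; exact bot_le
  · have hν : conj ν = ν := hT.conj_eigenvalue_eq_self (hasEigenvalue_iff.2 h)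
    obtain ⟨r, rfl⟩ := Complex.conj_eq_iff_real.1 hν
    have e : (r : ℂ) = ((r⁻¹ : ℝ) : ℂ)⁻¹ := by simp
    rw [e]
    exact le_biSup (fun μ : ℝ => Module.End.eigenspace (T : H →ₗ[ℂ] H) ((μ : ℂ)⁻¹)) (mem_univ r⁻¹)

/-- The orthogonal complement of the eigenvectors with eigenvalues `μ⁻¹`, `μ ∈ s`, is contained in
the closed span of the other eigenvectors. -/
theorem orthogonal_spectralSpan_le [CompleteSpace H] (hT : (T : H →ₗ[ℂ] H).IsSymmetric)
    (hc : IsCompactOperator T) (s : Set ℝ) :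
    (spectralSpan T s)ᗮ ≤ (spectralSpan T sᶜ).topologicalClosure := by
  have htop : (spectralSpan T univ)ᗮ = ⊥ := by
    rw [eq_bot_iff, ← ContinuousLinearMap.orthogonalComplement_iSup_eigenspaces_eq_bot hc hT]
    exact Submodule.orthogonal_le (iSup_le fun ν => eigenspace_le_spectralSpan_univ hT ν)
  set A := spectralSpan T sᶜ
  have : CompleteSpace A.topologicalClosure :=
    A.isClosed_topologicalClosure.completeSpace_coe
  intro y hy
  have hA : A.topologicalClosure ≤ (spectralSpan T s)ᗮ :=
    Submodule.topologicalClosure_minimal _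
      ((spectralSpan_isOrtho hT disjoint_compl_left).le) (Submodule.isClosed_orthogonal _)
  have h1 : y - A.topologicalClosure.starProjection y ∈ (spectralSpan T univ)ᗮ := by
    rw [← union_compl_self s, spectralSpan_union, ← Submodule.inf_orthogonal]
    refine ⟨sub_mem hy (hA (Submodule.starProjection_apply_mem _ _)), ?_⟩
    exact Submodule.orthogonal_le A.le_topologicalClosure
      (Submodule.sub_starProjection_mem_orthogonal (K := A.topologicalClosure) y)
  rw [htop, Submodule.mem_bot, sub_eq_zero] at h1
  rw [h1]
  exact Submodule.starProjection_apply_mem _ _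

theorem re_inner_le_of_mem_orthogonal [CompleteSpace H] (hT : (T : H →ₗ[ℂ] H).IsSymmetric)
    (hc : IsCompactOperator T) {c : ℝ} {s : Set ℝ} (hs : ∀ μ ∉ s, μ⁻¹ ≤ c) {y : H}
    (hy : y ∈ (spectralSpan T s)ᗮ) : (⟪T y, y⟫_ℂ).re ≤ c * ‖y‖ ^ 2 := by
  have hy' := orthogonal_spectralSpan_le hT hc s hy
  have hcl : IsClosed {y : H | (⟪T y, y⟫_ℂ).re ≤ c * ‖y‖ ^ 2} :=
    isClosed_le (by fun_prop) (by fun_prop)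
  exact closure_minimal (fun z hz => re_inner_le_of_mem_spectralSpan hT hs hz) hcl hy'

/-! ### The counting function -/

theorem finite_spectralSpan (hT : (T : H →ₗ[ℂ] H).IsSymmetric) {lam : ℝ} {r : ℕ}
    (L : H →ₗ[ℂ] (Fin r → ℂ)) (hL : ∀ y, L y = 0 → y ≠ 0 → (⟪T y, y⟫_ℂ).re < lam⁻¹ * ‖y‖ ^ 2) :
    FiniteDimensional ℂ (spectralSpan T (Ioc 0 lam)) ∧
      Module.finrank ℂ (spectralSpan T (Ioc 0 lam)) ≤ r := by
  have hinj : Function.Injective (L.comp (spectralSpan T (Ioc 0 lam)).subtype) := by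
    rw [← LinearMap.ker_eq_bot, LinearMap.ker_eq_bot']
    rintro ⟨y, hy⟩ h0
    by_contra hne
    have h1 := hL y h0 (fun h => hne (by simpa using h))
    refine h1.not_ge (le_re_inner_of_mem_spectralSpan hT (fun μ hμ => ?_) hy)
    exact inv_anti₀ hμ.1 hμ.2
  refine ⟨FiniteDimensional.of_injective _ hinj, ?_⟩
  simpa using LinearMap.finrank_le_finrank_of_injective hinj

theorem finrank_le_spectralSpan [CompleteSpace H] (hT : (T : H →ₗ[ℂ] H).IsSymmetric)
    (hc : IsCompactOperator T) {lam : ℝ} (hlam : 0 < lam)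
    [FiniteDimensional ℂ (spectralSpan T (Ioc 0 lam))]
    {E : Type*} [AddCommGroup E] [Module ℂ E] (f : E →ₗ[ℂ] H)
    (hf : ∀ y, y ≠ 0 → lam⁻¹ * ‖f y‖ ^ 2 < (⟪T (f y), f y⟫_ℂ).re) :
    Module.finrank ℂ E ≤ Module.finrank ℂ (spectralSpan T (Ioc 0 lam)) := by
  set V := spectralSpan T (Ioc 0 lam)
  have hinj : Function.Injective ((V.orthogonalProjectionOnto : H →ₗ[ℂ] V).comp f) := by
    rw [← LinearMap.ker_eq_bot, LinearMap.ker_eq_bot']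
    intro y h0
    by_contra hne
    refine (hf y hne).not_ge (re_inner_le_of_mem_orthogonal hT hc (s := Ioc 0 lam)
      (fun μ hμ => ?_) ?_)
    · rcases le_or_gt μ 0 with h | h
      · exact (inv_nonpos.2 h).trans (inv_nonneg.2 hlam.le)
      · exact inv_anti₀ hlam (not_le.1 fun h' => hμ ⟨h, h'⟩).le
    · exact Submodule.orthogonalProjectionOnto_eq_zero_iff.1 h0
  exact LinearMap.finrank_le_finrank_of_injective hinj

end SpectralTheory

section Counting

variable {H : Type*} [NormedAddCommGroup H] [InnerProductSpace ℂ H] {T : H →L[ℂ] H}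

/-- The number of eigenvalues of `T` in `[lam⁻¹, ∞)`, counted with multiplicity. -/
def spectralCount (T : H →L[ℂ] H) (lam : ℝ) : ℕ :=
  Module.finrank ℂ (spectralSpan T (Ioc 0 lam))

theorem spectralCount_mono (hfin : ∀ lam, FiniteDimensional ℂ (spectralSpan T (Ioc 0 lam))) :
    Monotone (spectralCount T) := fun _ lam' h =>
  have := hfin lam'
  Submodule.finrank_mono (spectralSpan_mono T (Ioc_subset_Ioc_right h))

theorem spectralCount_of_nonpos {lam : ℝ} (h : lam ≤ 0) : spectralCount T lam = 0 := by
  have h' : spectralSpan T ∅ = ⊥ := by simp [spectralSpan]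
  rw [spectralCount, Ioc_eq_empty_of_le h, h', finrank_bot]

theorem spectralSpan_eq_of_le_of_count (hfin : ∀ lam, FiniteDimensional ℂ
    (spectralSpan T (Ioc 0 lam))) {lam lam' : ℝ} (h : lam ≤ lam')
    (hc : spectralCount T lam' ≤ spectralCount T lam) :
    spectralSpan T (Ioc 0 lam) = spectralSpan T (Ioc 0 lam') :=
  have := hfin lam'
  Submodule.eq_of_le_of_finrank_le (spectralSpan_mono T (Ioc_subset_Ioc_right h)) hc

theorem exists_forall_nat_le {α : Type*} (f : α → ℕ) {s : Set α} (hs : s.Nonempty) :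
    ∃ a ∈ s, ∀ b ∈ s, f a ≤ f b := by
  obtain ⟨a, ha, h⟩ := (InvImage.wf f Nat.lt_wfRel.wf).has_min s hs
  exact ⟨a, ha, fun b hb => not_lt.1 (h b hb)⟩

theorem spectralCount_right_constant (hT : (T : H →ₗ[ℂ] H).IsSymmetric)
    (hfin : ∀ lam, FiniteDimensional ℂ (spectralSpan T (Ioc 0 lam))) (lam : ℝ) :
    ∃ lam' > lam, spectralCount T lam' = spectralCount T lam := by
  obtain ⟨lam', hl, hmin⟩ := exists_forall_nat_le (spectralCount T) (nonempty_Ioi (a := lam))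
  refine ⟨lam', hl, ?_⟩
  suffices h : spectralSpan T (Ioc 0 lam') ≤ spectralSpan T (Ioc 0 lam) by
    have := hfin lam
    exact le_antisymm (Submodule.finrank_mono h) (spectralCount_mono hfin (le_of_lt hl))
  refine iSup₂_le fun μ hμ => ?_
  rcases le_or_gt μ lam with h | h
  · exact le_biSup (fun μ : ℝ => Module.End.eigenspace (T : H →ₗ[ℂ] H) ((μ : ℂ)⁻¹)) ⟨hμ.1, h⟩
  · have hν : lam < (lam + μ) / 2 ∧ (lam + μ) / 2 < μ := ⟨by linarith, by linarith⟩
    have e := spectralSpan_eq_of_le_of_count hfin (hν.2.le.trans hμ.2) (hmin _ hν.1)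
    have h1 : spectralSpan T {μ} ≤ spectralSpan T (Ioc 0 ((lam + μ) / 2)) := by
      rw [e]
      exact spectralSpan_mono T (singleton_subset_iff.2 hμ)
    have h2 : spectralSpan T {μ} ⟂ spectralSpan T (Ioc 0 ((lam + μ) / 2)) :=
      spectralSpan_isOrtho hT (disjoint_singleton_left.2 fun h' => hν.2.not_ge h'.2)
    have h3 : spectralSpan T {μ} = ⊥ := Submodule.isOrtho_self.1 (h2.mono_right h1)
    rw [← spectralSpan_singleton, h3]
    exact bot_le

theorem spectralCount_left_jump (hT : (T : H →ₗ[ℂ] H).IsSymmetric)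
    (hfin : ∀ lam, FiniteDimensional ℂ (spectralSpan T (Ioc 0 lam))) {μ : ℝ} (hμ : 0 < μ) :
    ∃ lam < μ, (∀ ν < μ, spectralCount T ν ≤ spectralCount T lam) ∧ spectralCount T μ =
      spectralCount T lam + Module.finrank ℂ (Module.End.eigenspace (T : H →ₗ[ℂ] H) (μ : ℂ)⁻¹) := by
  obtain ⟨lam, hl, hmin⟩ := exists_forall_nat_le
    (fun ν => spectralCount T μ - spectralCount T ν) (nonempty_Iio (a := μ))
  have hmono := spectralCount_mono hfin
  have hmax : ∀ ν < μ, spectralCount T ν ≤ spectralCount T lam := by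
    intro ν hν
    have h1 := hmin ν hν
    have h2 := hmono (le_of_lt hl)
    have h3 := hmono hν.le
    omega
  refine ⟨lam, hl, hmax, ?_⟩
  have hspan : spectralSpan T (Ioo 0 μ) = spectralSpan T (Ioc 0 lam) := by
    refine le_antisymm (iSup₂_le fun ν hν => ?_)
      (spectralSpan_mono T fun x hx => ⟨hx.1, hx.2.trans_lt hl⟩)
    rw [spectralSpan_eq_of_le_of_count hfin (le_max_left lam ν) (hmax _ (max_lt hl hν.2))]
    exact le_biSup (fun μ : ℝ => Module.End.eigenspace (T : H →ₗ[ℂ] H) ((μ : ℂ)⁻¹))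
      ⟨hν.1, le_max_right lam ν⟩
  have hun : spectralSpan T (Ioc 0 μ) = spectralSpan T (Ioc 0 lam) ⊔ spectralSpan T {μ} := by
    rw [← hspan, ← spectralSpan_union, union_singleton, Ioo_insert_right hμ]
  have hdis : spectralSpan T (Ioc 0 lam) ⊓ spectralSpan T {μ} = ⊥ :=
    disjoint_iff.1 (spectralSpan_isOrtho hT
      (disjoint_singleton_right.2 fun h' => h'.2.not_gt hl)).disjoint
  have := hfin μ
  have : FiniteDimensional ℂ (spectralSpan T (Ioc 0 lam)) := hfin lam
  have : FiniteDimensional ℂ (spectralSpan T {μ}) :=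
    Submodule.finiteDimensional_of_le (hun ▸ le_sup_right :
      spectralSpan T {μ} ≤ spectralSpan T (Ioc 0 μ))
  have h := Submodule.finrank_sup_add_finrank_inf_eq (spectralSpan T (Ioc 0 lam))
    (spectralSpan T {μ})
  rw [hdis, finrank_bot, add_zero, ← hun, spectralSpan_singleton] at h
  exact h

/-- The reciprocals of the positive eigenvalues can be enumerated by the counting function. -/
theorem exists_enumeration (hT : (T : H →ₗ[ℂ] H).IsSymmetric)
    (hfin : ∀ lam, FiniteDimensional ℂ (spectralSpan T (Ioc 0 lam)))
    (hunb : ∀ k, ∃ lam, k ≤ spectralCount T lam) :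
    ∃ lam : ℕ → ℝ, (∀ k, 1 ≤ k → ∀ μ, lam k ≤ μ ↔ k ≤ spectralCount T μ) ∧
      ∀ μ : ℝ, 0 < μ → {k : ℕ | 1 ≤ k ∧ lam k = μ}.Finite ∧ {k : ℕ | 1 ≤ k ∧ lam k = μ}.ncard =
        Module.finrank ℂ (Module.End.eigenspace (T : H →ₗ[ℂ] H) (μ : ℂ)⁻¹) := by
  have hmono := spectralCount_mono hfin
  have key : ∀ k, 1 ≤ k → ∀ μ, sInf {ν | k ≤ spectralCount T ν} ≤ μ ↔ k ≤ spectralCount T μ := by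
    intro k hk μ
    have hbdd : BddBelow {ν | k ≤ spectralCount T ν} := by
      refine ⟨0, fun ν hν => ?_⟩
      by_contra hneg
      have h1 : k ≤ spectralCount T ν := hν
      rw [spectralCount_of_nonpos (not_le.1 hneg).le] at h1
      omega
    refine ⟨fun h => ?_, fun h => csInf_le hbdd h⟩
    obtain ⟨μ', hμ', e⟩ := spectralCount_right_constant hT hfin μ
    obtain ⟨ν, hν, hνμ⟩ := exists_lt_of_csInf_lt (hunb k) (h.trans_lt hμ')
    rw [← e]
    exact le_trans hν (hmono hνμ.le)
  refine ⟨fun k => sInf {ν | k ≤ spectralCount T ν}, key, fun μ hμ => ?_⟩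
  obtain ⟨lam, hl, hmax, hjump⟩ := spectralCount_left_jump hT hfin hμ
  have hset : {k : ℕ | 1 ≤ k ∧ sInf {ν | k ≤ spectralCount T ν} = μ} =
      (Finset.Ioc (spectralCount T lam) (spectralCount T μ) : Set ℕ) := by
    ext k
    simp only [mem_ofPred_eq, Finset.coe_Ioc, mem_Ioc]
    constructor
    · rintro ⟨hk, e⟩
      refine ⟨?_, (key k hk μ).1 e.le⟩
      by_contra hle
      have := (key k hk lam).2 (not_lt.1 hle)
      rw [e] at this
      exact this.not_gt hl
    · rintro ⟨h1, h2⟩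
      have hk : 1 ≤ k := by omega
      refine ⟨hk, le_antisymm ((key k hk μ).2 h2) ?_⟩
      by_contra hlt
      have := (key k hk _).1 le_rfl
      have := hmax _ (not_le.1 hlt)
      omega
  rw [hset]
  refine ⟨Finset.finite_toSet _, ?_⟩
  rw [Set.ncard_coe_finset, Nat.card_Ioc, hjump]
  omega

end Counting

section Asymptotics

theorem exists_tendsto_of_le_add {κ C c : ℝ} (hκ : 0 < κ) (hκ1 : κ < 1) (hc : 0 < c) {x : ℕ → ℝ}
    (hx : ∀ k, x (k + 1) ≤ x k / κ + C) (hC : 0 ≤ C) {k₀ : ℕ} (hlow : ∀ k, k₀ ≤ k → c ≤ κ ^ k * x k) :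
    ∃ τ > 0, Tendsto (fun k => κ ^ k * x k) atTop (𝓝 τ) := by
  have hsum : Summable fun k : ℕ => C * κ ^ (k + 1) :=
    ((summable_nat_add_iff 1).2 (summable_geometric_of_lt_one hκ.le hκ1)).mul_left C
  have hS := hsum.hasSum.tendsto_sum_nat
  set w : ℕ → ℝ := fun k => κ ^ k * x k - ∑ i ∈ Finset.range k, C * κ ^ (i + 1) with hw
  have hanti : Antitone w := by
    refine antitone_nat_of_succ_le fun k => ?_
    simp only [hw, Finset.sum_range_succ]
    have h1 : κ ^ (k + 1) * x (k + 1) ≤ κ ^ (k + 1) * (x k / κ + C) := by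
      gcongr
      exact hx k
    have h2 : κ ^ (k + 1) * (x k / κ + C) = κ ^ k * x k + C * κ ^ (k + 1) := by
      field_simp
      ring
    linarith
  have hbdd : BddBelow (range w) := by
    refine ⟨c - ∑' k : ℕ, C * κ ^ (k + 1), ?_⟩
    rintro _ ⟨k, rfl⟩
    refine le_trans ?_ (hanti (le_max_left k k₀))
    exact sub_le_sub (hlow _ (le_max_right _ _))
      (hsum.sum_le_tsum _ fun i _ => by positivity)
  have hlim : Tendsto (fun k => κ ^ k * x k) atTop
      (𝓝 ((⨅ k, w k) + ∑' k : ℕ, C * κ ^ (k + 1))) := by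
    refine ((tendsto_atTop_ciInf hanti hbdd).add hS).congr fun k => ?_
    simp [hw]
  refine ⟨_, lt_of_lt_of_le hc ?_, hlim⟩
  exact ge_of_tendsto hlim ((eventually_ge_atTop k₀).mono hlow)

theorem isEquivalent_of_tendsto_pow_mul {κ τ : ℝ} (hκ : 0 < κ) (hτ : 0 < τ) {x : ℕ → ℝ}
    (h : Tendsto (fun k => κ ^ k * x k) atTop (𝓝 τ)) :
    x ~[atTop] fun k => τ * (κ ^ k)⁻¹ := by
  rw [isEquivalent_iff_tendsto_one (Eventually.of_forall fun k => by positivity)]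
  have h1 := h.div_const τ
  rw [div_self hτ.ne'] at h1
  refine h1.congr fun k => ?_
  simp only [Pi.div_apply]
  field_simp

variable {H : Type*} [NormedAddCommGroup H] [InnerProductSpace ℂ H] {T : H →L[ℂ] H}

/-- Two-sided estimates for the counting function which determine the eigenvalue asymptotics. -/
theorem exists_enumeration_asymptotics (hT : (T : H →ₗ[ℂ] H).IsSymmetric)
    (hfin : ∀ lam, FiniteDimensional ℂ (spectralSpan T (Ioc 0 lam)))
    {κ C B : ℝ} {Z r : ℕ} (hκ : 0 < κ) (hκ1 : κ < 1) (hZ : 0 < Z) (hC : 0 ≤ C) (hB : 0 < B)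
    (hlower : ∀ lam, C < lam → spectralCount T (κ * (lam - C)) + Z ≤ spectralCount T lam)
    (hupper : ∀ J : ℕ, ∀ lam, lam * (B * κ ^ J) < 1 → spectralCount T lam ≤ J * Z + r) :
    ∃ lam : ℕ → ℝ, (∀ k, 1 ≤ k → 0 < lam k) ∧ (∀ j k, 1 ≤ j → j ≤ k → lam j ≤ lam k) ∧
      (∀ μ : ℝ, 0 < μ → {k : ℕ | 1 ≤ k ∧ lam k = μ}.Finite ∧ {k : ℕ | 1 ≤ k ∧ lam k = μ}.ncard =
        Module.finrank ℂ (Module.End.eigenspace (T : H →ₗ[ℂ] H) (μ : ℂ)⁻¹)) ∧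
      ∃ τ : ℕ → ℝ, ∀ l, 1 ≤ l → 0 < τ l ∧
        (fun k : ℕ => lam (l + k * Z)) ~[atTop] fun k : ℕ => τ l * (κ ^ k)⁻¹ := by
  have hunb : ∀ k, ∃ lam, k ≤ spectralCount T lam := by
    suffices h : ∀ j : ℕ, ∃ lam, 0 ≤ lam ∧ j * Z ≤ spectralCount T lam by
      intro k
      obtain ⟨lam, -, h1⟩ := h k
      exact ⟨lam, (Nat.le_mul_of_pos_right k hZ).trans h1⟩
    intro j
    induction j with
    | zero => exact ⟨0, le_rfl, by simp⟩
    | succ j ih =>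
      obtain ⟨lam, h0, h1⟩ := ih
      have hpos : 0 ≤ (lam + 1) / κ := by positivity
      refine ⟨(lam + 1) / κ + C, by positivity, ?_⟩
      have h2 := hlower ((lam + 1) / κ + C) (by
        have : 0 < (lam + 1) / κ := by positivity
        linarith)
      have e : κ * ((lam + 1) / κ + C - C) = lam + 1 := by field_simp; ring
      rw [e] at h2
      have h3 := spectralCount_mono hfin (show lam ≤ lam + 1 by linarith)
      rw [Nat.succ_mul]
      omega
  obtain ⟨lam, hkey, hmult⟩ := exists_enumeration hT hfin hunb
  have hpos : ∀ k, 1 ≤ k → 0 < lam k := by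
    intro k hk
    by_contra h
    have h1 := (hkey k hk 0).1 (not_lt.1 h)
    rw [spectralCount_of_nonpos le_rfl] at h1
    omega
  have hmono : ∀ j k, 1 ≤ j → j ≤ k → lam j ≤ lam k := fun j k hj hjk =>
    (hkey j hj _).2 (hjk.trans ((hkey k (hj.trans hjk) _).1 le_rfl))
  have hstep : ∀ k, 1 ≤ k → lam (k + Z) ≤ lam k / κ + C := by
    intro k hk
    have h0 := hpos k hk
    rw [hkey _ (by omega)]
    have h2 := hlower (lam k / κ + C) (by
      have : 0 < lam k / κ := by positivity
      linarith)
    have e : κ * (lam k / κ + C - C) = lam k := by field_simp; ring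
    rw [e] at h2
    have := (hkey k hk _).1 le_rfl
    omega
  have hlow : ∀ J : ℕ, 1 / (2 * B) ≤ κ ^ J * lam (J * Z + r + 1) := by
    intro J
    by_contra hlt
    rw [not_le, lt_div_iff₀ (by positivity)] at hlt
    have h1 := hupper J (lam (J * Z + r + 1)) (by
      have : 0 < κ ^ J * lam (J * Z + r + 1) * B := by
        have := hpos (J * Z + r + 1) (by omega)
        positivity
      nlinarith)
    have := (hkey (J * Z + r + 1) (by omega) _).1 le_rfl
    omega
  have htau : ∀ l, 1 ≤ l → ∃ τ > 0, Tendsto (fun k => κ ^ k * lam (l + k * Z)) atTop (𝓝 τ) := by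
    intro l hl
    refine exists_tendsto_of_le_add (C := C) (c := κ ^ (r + 1) * (1 / (2 * B))) (k₀ := r + 1) hκ hκ1
      (by positivity) (fun k => ?_) hC (fun k hk => ?_)
    · have h := hstep (l + k * Z) (by omega)
      rwa [show l + k * Z + Z = l + (k + 1) * Z by ring] at h
    · obtain ⟨J, rfl⟩ := Nat.exists_eq_add_of_le hk
      rw [pow_add κ (r + 1) J, mul_assoc (κ ^ (r + 1)) (κ ^ J)]
      refine mul_le_mul_of_nonneg_left ((hlow J).trans ?_) (by positivity)
      refine mul_le_mul_of_nonneg_left (hmono _ _ (by omega) ?_) (by positivity)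
      have : r + 1 ≤ (r + 1) * Z := Nat.le_mul_of_pos_right _ hZ
      rw [add_mul]
      omega
  choose! τ hτ hlim using htau
  exact ⟨lam, hpos, hmono, hmult, τ, fun l hl =>
    ⟨hτ l hl, isEquivalent_of_tendsto_pow_mul hκ (hτ l hl) (hlim l hl)⟩⟩

end Asymptotics

section Sobolev

/-! ### Iterated primitives of square integrable functions -/

theorem norm_integral_le_sqrt_mul_norm (G : Lp ℂ 2 (volume : Measure ℝ)) (a b : ℝ) :
    ‖∫ t in a..b, G t‖ ≤ √|b - a| * ‖G‖ := by
  have hμ : (volume : Measure ℝ) (uIoc a b) ≠ ⊤ := by simp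
  rw [intervalIntegral.norm_integral_eq_norm_integral_uIoc,
    ← L2.inner_indicatorConstLp_one (𝕜 := ℂ) measurableSet_uIoc hμ G]
  refine (norm_inner_le_norm _ _).trans ?_
  gcongr
  rw [norm_indicatorConstLp two_ne_zero ENNReal.ofNat_ne_top]
  simp [measureReal_def, Real.sqrt_eq_rpow]

theorem locallyIntegrable_of_memLp_two {g : ℝ → ℂ} (hg : MemLp g 2 volume) :
    LocallyIntegrable g volume :=
  hg.locallyIntegrable (by norm_num)

theorem intervalIntegrable_of_memLp_two {g : ℝ → ℂ} (hg : MemLp g 2 volume) (a b : ℝ) :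
    IntervalIntegrable g volume a b :=
  ((locallyIntegrable_of_memLp_two hg).integrableOn_isCompact isCompact_uIcc).intervalIntegrable

theorem integrable_coeFn_Lp (G : Lp ℂ 2 (volume : Measure ℝ)) (a b : ℝ) :
    IntervalIntegrable G volume a b :=
  intervalIntegrable_of_memLp_two (Lp.memLp G) a b

/-- A bound for repeated primitives with base point `x₀`. -/
theorem norm_le_of_iterated_primitive (G : Lp ℂ 2 (volume : Measure ℝ)) {x₀ : ℝ} {J : ℕ}
    {F : ℕ → ℝ → ℂ} (h0 : ∀ x, F 0 x = ∫ t in x₀..x, G t)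
    (hs : ∀ j < J, ∀ x, F (j + 1) x = ∫ t in x₀..x, F j t) :
    ∀ j ≤ J, ∀ x, ‖F j x‖ ≤ |x - x₀| ^ j * √|x - x₀| * ‖G‖ := by
  intro j
  induction j with
  | zero =>
    intro _ x
    rw [h0, pow_zero, one_mul]
    exact norm_integral_le_sqrt_mul_norm G x₀ x
  | succ j ih =>
    intro hj x
    rw [hs j hj]
    refine (intervalIntegral.norm_integral_le_of_norm_le_const
      (C := |x - x₀| ^ j * √|x - x₀| * ‖G‖) fun t ht => ?_).trans (le_of_eq (by ring))
    have ht' : |t - x₀| ≤ |x - x₀| := by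
      rcases le_total x₀ x with h | h
      · rw [uIoc_of_le h] at ht
        rw [abs_of_nonneg (by linarith [ht.1]), abs_of_nonneg (by linarith)]
        linarith [ht.2]
      · rw [uIoc_of_ge h] at ht
        rw [abs_of_nonpos (by linarith [ht.2]), abs_of_nonpos (by linarith)]
        linarith [ht.1]
    refine (ih (by omega) t).trans ?_
    gcongr

/-- The `(j+1)`-fold primitive of `G` with base point `0`. -/
def iteratedPrimitive (G : ℝ → ℂ) : ℕ → ℝ → ℂ
  | 0 => fun x => ∫ t in (0 : ℝ)..x, G t
  | j + 1 => fun x => ∫ t in (0 : ℝ)..x, iteratedPrimitive G j t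

theorem contDiff_iteratedPrimitive (G : Lp ℂ 2 (volume : Measure ℝ)) (j : ℕ) :
    ContDiff ℝ j (iteratedPrimitive G j) := by
  induction j with
  | zero =>
    exact contDiff_zero.2 (intervalIntegral.continuous_primitive (integrable_coeFn_Lp G) 0)
  | succ j ih =>
    have hd : ∀ x, HasDerivAt (iteratedPrimitive G (j + 1)) (iteratedPrimitive G j x) x := fun x =>
      (ih.continuous.integral_hasStrictDerivAt 0 x).hasDerivAt
    rw [Nat.cast_succ, contDiff_succ_iff_deriv]
    refine ⟨fun x => (hd x).differentiableAt, by simp, ?_⟩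
    rwa [show deriv (iteratedPrimitive G (j + 1)) = iteratedPrimitive G j from
      funext fun x => (hd x).deriv]

theorem deriv_iteratedPrimitive_succ (G : Lp ℂ 2 (volume : Measure ℝ)) (j : ℕ) :
    deriv (iteratedPrimitive G (j + 1)) = iteratedPrimitive G j :=
  funext fun x => (contDiff_iteratedPrimitive G j).continuous.deriv_integral _ 0 x

theorem iteratedDeriv_iteratedPrimitive (G : Lp ℂ 2 (volume : Measure ℝ)) (j : ℕ) :
    iteratedDeriv j (iteratedPrimitive G j) = iteratedPrimitive G 0 := by
  induction j with
  | zero => exact iteratedDeriv_zero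
  | succ j ih => rw [iteratedDeriv_succ', deriv_iteratedPrimitive_succ, ih]

theorem iteratedPrimitive_congr {F G : ℝ → ℂ} (h : F =ᵐ[volume] G) (j : ℕ) :
    iteratedPrimitive F j = iteratedPrimitive G j := by
  induction j with
  | zero =>
    funext x
    exact intervalIntegral.integral_congr_ae (h.mono fun t ht _ => ht)
  | succ j ih => simp only [iteratedPrimitive, ih]

theorem iteratedPrimitive_add (F G : Lp ℂ 2 (volume : Measure ℝ)) (j : ℕ) :
    iteratedPrimitive (F + G : Lp ℂ 2 (volume : Measure ℝ)) j =
      iteratedPrimitive F j + iteratedPrimitive G j := by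
  induction j with
  | zero =>
    rw [iteratedPrimitive_congr (Lp.coeFn_add F G)]
    funext x
    exact intervalIntegral.integral_add (integrable_coeFn_Lp F _ _) (integrable_coeFn_Lp G _ _)
  | succ j ih =>
    funext x
    simp only [iteratedPrimitive, ih, Pi.add_apply]
    exact intervalIntegral.integral_add
      ((contDiff_iteratedPrimitive F j).continuous.intervalIntegrable _ _)
      ((contDiff_iteratedPrimitive G j).continuous.intervalIntegrable _ _)

theorem iteratedPrimitive_smul (c : ℂ) (G : Lp ℂ 2 (volume : Measure ℝ)) (j : ℕ) :
    iteratedPrimitive (c • G : Lp ℂ 2 (volume : Measure ℝ)) j = c • iteratedPrimitive G j := by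
  induction j with
  | zero =>
    rw [iteratedPrimitive_congr (Lp.coeFn_smul c G)]
    funext x
    exact intervalIntegral.integral_smul c _
  | succ j ih =>
    funext x
    simp only [iteratedPrimitive, ih, Pi.smul_apply]
    exact intervalIntegral.integral_smul c _

/-- `G ↦ iteratedPrimitive G j x` as a continuous linear functional on `L²(ℝ)`. -/
def iteratedPrimitiveCLM (j : ℕ) (x : ℝ) : Lp ℂ 2 (volume : Measure ℝ) →L[ℂ] ℂ :=
  LinearMap.mkContinuous
    { toFun := fun G => iteratedPrimitive G j x
      map_add' := fun F G => congrFun (iteratedPrimitive_add F G j) x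
      map_smul' := fun c G => congrFun (iteratedPrimitive_smul c G j) x }
    (|x - 0| ^ j * √|x - 0|) fun G =>
      norm_le_of_iterated_primitive G (fun _ => rfl) (fun _ _ _ => rfl) j le_rfl x

/-! ### The derivatives of a function in `W̊₂ⁿ[0,1]` -/

variable {n : ℕ}

theorem continuous_iteratedDeriv {y : ℝ → ℂ} (hy : y ∈ dirichletSobolev n) {j : ℕ}
    (hj : j ≤ n - 1) : Continuous (iteratedDeriv j y) :=
  hy.2.1.continuous_iteratedDeriv j (by exact_mod_cast hj)

theorem iteratedDeriv_eq_zero_of_notMem_Icc {y : ℝ → ℂ} (hy : y ∈ dirichletSobolev n) (j : ℕ)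
    {x : ℝ} (hx : x ∉ Icc (0 : ℝ) 1) : iteratedDeriv j y x = 0 := by
  have h : y =ᶠ[𝓝 x] fun _ => 0 := by
    filter_upwards [isClosed_Icc.isOpen_compl.mem_nhds hx] with t ht
    exact hy.1 t fun h => ht (Ioo_subset_Icc_self h)
  rw [h.iteratedDeriv_eq]
  simp

theorem iteratedDeriv_eq_zero_of_notMem_Ioo {y : ℝ → ℂ} (hy : y ∈ dirichletSobolev n) {j : ℕ}
    (hj : j ≤ n - 1) {x : ℝ} (hx : x ∉ Ioo (0 : ℝ) 1) : iteratedDeriv j y x = 0 := by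
  have hcl : IsClosed {x | iteratedDeriv j y x = 0} :=
    isClosed_eq (continuous_iteratedDeriv hy hj) continuous_const
  have hsub : (Icc (0 : ℝ) 1)ᶜ ⊆ {x | iteratedDeriv j y x = 0} := fun x hx =>
    iteratedDeriv_eq_zero_of_notMem_Icc hy j hx
  refine hcl.closure_subset_iff.2 hsub ?_
  rwa [closure_compl, interior_Icc]

theorem memLp_iteratedDeriv (hn : 1 < n) {y : ℝ → ℂ} (hy : y ∈ dirichletSobolev n) :
    MemLp (iteratedDeriv n y) 2 volume := by
  have h := (memLp_indicator_iff_restrict measurableSet_Icc).2 (ae_hasDerivAt hn hy).2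
  rwa [indicator_eq_self.2] at h
  intro x hx
  by_contra hx'
  exact hx (iteratedDeriv_eq_zero_of_notMem_Icc hy n hx')

theorem iteratedDeriv_pred_eq_integral (hn : 1 < n) {y : ℝ → ℂ} (hy : y ∈ dirichletSobolev n)
    (x : ℝ) : iteratedDeriv (n - 1) y x = ∫ t in (0 : ℝ)..x, iteratedDeriv n y t := by
  have hint : ∀ a b, IntervalIntegrable (iteratedDeriv n y) volume a b := fun a b =>
    intervalIntegrable_of_memLp_two (memLp_iteratedDeriv hn hy) a b
  have hIcc : ∀ x ∈ Icc (0 : ℝ) 1,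
      iteratedDeriv (n - 1) y x = ∫ t in (0 : ℝ)..x, iteratedDeriv n y t := by
    intro x hx
    obtain ⟨g, hg, hyg⟩ := hy.2.2
    have hae : ∀ᵐ t, t ∈ Ioo (0 : ℝ) 1 → iteratedDeriv n y t = g t := by
      filter_upwards [(intervalIntegrable_of_memLp hg
        (right_mem_Icc.2 zero_le_one)).ae_hasDerivAt_integral] with t ht h01
      have h1 := ht (by rw [uIcc_of_le zero_le_one]; exact Ioo_subset_Icc_self h01) 0 (by simp)
      have h2 : HasDerivAt (iteratedDeriv (n - 1) y) (g t) t := by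
        refine h1.congr_of_eventuallyEq ?_
        filter_upwards [isOpen_Ioo.mem_nhds h01] with s hs
        exact hyg s (Ioo_subset_Icc_self hs)
      obtain ⟨m, rfl⟩ : ∃ m, n = m + 1 := ⟨n - 1, by omega⟩
      rw [iteratedDeriv_succ]
      exact h2.deriv
    rw [hyg x hx]
    refine intervalIntegral.integral_congr_ae ?_
    filter_upwards [hae, (measure_eq_zero_iff_ae_notMem.1 (measure_singleton (1 : ℝ)))]
      with t ht h1 hxt
    rw [uIoc_of_le hx.1] at hxt
    exact (ht ⟨hxt.1, lt_of_le_of_ne (hxt.2.trans hx.2) h1⟩).symm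
  rcases lt_or_ge x 0 with h0 | h0
  · rw [iteratedDeriv_eq_zero_of_notMem_Icc hy _ fun h => h0.not_ge h.1,
      intervalIntegral.integral_zero_ae]
    filter_upwards [measure_eq_zero_iff_ae_notMem.1 (measure_singleton (0 : ℝ))] with t ht hxt
    rw [uIoc_of_ge h0.le] at hxt
    exact iteratedDeriv_eq_zero_of_notMem_Icc hy n fun h =>
      ht (le_antisymm hxt.2 h.1)
  rcases le_or_gt x 1 with h1 | h1
  · exact hIcc x ⟨h0, h1⟩
  · rw [iteratedDeriv_eq_zero_of_notMem_Icc hy _ fun h => h1.not_ge h.2,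
      ← intervalIntegral.integral_add_adjacent_intervals (hint 0 1) (hint 1 x),
      ← hIcc 1 (right_mem_Icc.2 zero_le_one),
      iteratedDeriv_eq_zero_of_notMem_Ioo hy le_rfl (fun h => h.2.false), zero_add, eq_comm]
    refine intervalIntegral.integral_zero_ae (Eventually.of_forall fun t ht => ?_)
    rw [uIoc_of_le h1.le] at ht
    exact iteratedDeriv_eq_zero_of_notMem_Icc hy n fun h => ht.1.not_ge h.2

theorem mem_dirichletSobolev_of_integral {y : ℝ → ℂ} (h0 : ∀ x ∉ Ioo (0 : ℝ) 1, y x = 0)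
    (hc : ContDiff ℝ (n - 1 : ℕ) y) {g : ℝ → ℂ} (hg : MemLp g 2 volume)
    (hyg : ∀ x, iteratedDeriv (n - 1) y x = ∫ t in (0 : ℝ)..x, g t) : y ∈ dirichletSobolev n :=
  ⟨h0, hc, g, hg.restrict _, fun x _ => hyg x⟩

theorem iteratedDeriv_ae_eq (hn : 1 < n) {y g : ℝ → ℂ} (hg : MemLp g 2 volume)
    (hyg : ∀ x, iteratedDeriv (n - 1) y x = ∫ t in (0 : ℝ)..x, g t) :
    iteratedDeriv n y =ᵐ[volume] g := by
  filter_upwards [_root_.LocallyIntegrable.ae_hasDerivAt_integral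
    (locallyIntegrable_of_memLp_two hg)] with x hx
  obtain ⟨m, rfl⟩ : ∃ m, n = m + 1 := ⟨n - 1, by omega⟩
  rw [iteratedDeriv_succ]
  rw [show iteratedDeriv m y = fun x => ∫ t in (0 : ℝ)..x, g t from funext hyg]
  exact (hx 0).deriv

/-! ### The energy space as a closed subspace of `L²(ℝ)` -/

/-- The map `y ↦ y⁽ⁿ⁾`. -/
def topDeriv (n : ℕ) (hn : 1 < n) : dirichletSobolev n →ₗ[ℂ] Lp ℂ 2 (volume : Measure ℝ) where
  toFun y := (memLp_iteratedDeriv hn y.2).toLp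
  map_add' y z := by
    rw [← MemLp.toLp_add, MemLp.toLp_eq_toLp_iff]
    refine iteratedDeriv_ae_eq hn ((memLp_iteratedDeriv hn y.2).add (memLp_iteratedDeriv hn z.2))
      fun x => ?_
    have e : iteratedDeriv (n - 1) (y + z : ℝ → ℂ) x = _ :=
      iteratedDeriv_add y.2.2.1.contDiffAt z.2.2.1.contDiffAt
    rw [Submodule.coe_add, e, iteratedDeriv_pred_eq_integral hn y.2,
      iteratedDeriv_pred_eq_integral hn z.2]
    exact (intervalIntegral.integral_add
      (intervalIntegrable_of_memLp_two (memLp_iteratedDeriv hn y.2) _ _)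
      (intervalIntegrable_of_memLp_two (memLp_iteratedDeriv hn z.2) _ _)).symm
  map_smul' c y := by
    rw [RingHom.id_apply, ← MemLp.toLp_const_smul, MemLp.toLp_eq_toLp_iff]
    refine iteratedDeriv_ae_eq hn ((memLp_iteratedDeriv hn y.2).const_smul c) fun x => ?_
    rw [Submodule.coe_smul, iteratedDeriv_const_smul y.2.2.1.contDiffAt,
      iteratedDeriv_pred_eq_integral hn y.2]
    exact (intervalIntegral.integral_smul c _).symm

theorem coeFn_topDeriv (hn : 1 < n) (y : dirichletSobolev n) :
    topDeriv n hn y =ᵐ[volume] iteratedDeriv n (y : ℝ → ℂ) :=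
  MemLp.coeFn_toLp (memLp_iteratedDeriv hn y.2)

theorem iteratedPrimitive_topDeriv (hn : 1 < n) (y : dirichletSobolev n) {j : ℕ} (hj : j < n) :
    iteratedPrimitive (topDeriv n hn y) j = iteratedDeriv (n - 1 - j) (y : ℝ → ℂ) := by
  rw [iteratedPrimitive_congr (coeFn_topDeriv hn y)]
  induction j with
  | zero => exact funext fun x => (iteratedDeriv_pred_eq_integral hn y.2 x).symm
  | succ j ih =>
    funext x
    rw [iteratedPrimitive, ih (by omega)]
    have e : iteratedDeriv (n - 1 - j) (y : ℝ → ℂ) =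
        deriv (iteratedDeriv (n - 1 - (j + 1)) (y : ℝ → ℂ)) := by
      rw [← iteratedDeriv_succ]
      congr 1
      omega
    have hd : Differentiable ℝ (iteratedDeriv (n - 1 - (j + 1)) (y : ℝ → ℂ)) :=
      y.2.2.1.differentiable_iteratedDeriv _ (by exact_mod_cast (by omega))
    simp only [e]
    rw [intervalIntegral.integral_deriv_eq_sub (fun t _ => hd t)]
    · rw [iteratedDeriv_eq_zero_of_notMem_Ioo y.2 (by omega) fun h => h.1.false, sub_zero]
    · rw [← e]
      exact (continuous_iteratedDeriv y.2 (by omega)).intervalIntegrable _ _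

theorem topDeriv_injective (hn : 1 < n) : Function.Injective (topDeriv n hn) := by
  intro y z h
  have h1 := iteratedPrimitive_topDeriv hn y (j := n - 1) (by omega)
  have h2 := iteratedPrimitive_topDeriv hn z (j := n - 1) (by omega)
  rw [h, h2] at h1
  simpa using h1.symm

/-- The energy space: the range of `y ↦ y⁽ⁿ⁾`. -/
abbrev energySpace (n : ℕ) (hn : 1 < n) : Submodule ℂ (Lp ℂ 2 (volume : Measure ℝ)) :=
  LinearMap.range (topDeriv n hn)

theorem isClosed_energySpace (hn : 1 < n) :
    IsClosed (energySpace n hn : Set (Lp ℂ 2 (volume : Measure ℝ))) := by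
  rw [← closure_subset_iff_isClosed]
  intro G hG
  have hzero : ∀ j < n, ∀ x ∉ Ioo (0 : ℝ) 1, iteratedPrimitive G j x = 0 := by
    intro j hj x hx
    have hcl : IsClosed {G | iteratedPrimitiveCLM j x G = 0} :=
      isClosed_eq (iteratedPrimitiveCLM j x).continuous continuous_const
    refine closure_minimal ?_ hcl hG
    rintro _ ⟨y, rfl⟩
    change iteratedPrimitive (topDeriv n hn y) j x = 0
    rw [iteratedPrimitive_topDeriv hn y hj]
    exact iteratedDeriv_eq_zero_of_notMem_Ioo y.2 (by omega) hx
  have hint : ∀ x, iteratedDeriv (n - 1) (iteratedPrimitive G (n - 1)) x =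
      ∫ t in (0 : ℝ)..x, G t := fun x =>
    congrFun (iteratedDeriv_iteratedPrimitive G (n - 1)) x
  have hmem : iteratedPrimitive G (n - 1) ∈ dirichletSobolev n :=
    mem_dirichletSobolev_of_integral (hzero _ (by omega)) (contDiff_iteratedPrimitive G (n - 1))
      (Lp.memLp G) hint
  refine ⟨⟨_, hmem⟩, Lp.ext ?_⟩
  exact (coeFn_topDeriv hn _).trans (iteratedDeriv_ae_eq hn (Lp.memLp G) hint)

instance (hn : 1 < n) : CompleteSpace (energySpace n hn) :=
  (isClosed_energySpace hn).completeSpace_coe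

/-- The identification of `W̊₂ⁿ[0,1]` with the energy space. -/
def energyEquiv (n : ℕ) (hn : 1 < n) : dirichletSobolev n ≃ₗ[ℂ] energySpace n hn :=
  LinearEquiv.ofInjective (topDeriv n hn) (topDeriv_injective hn)

theorem norm_energyEquiv (hn : 1 < n) (y : dirichletSobolev n) :
    ‖energyEquiv n hn y‖ = ‖topDeriv n hn y‖ := rfl

/-- A function in `W̊₂ⁿ[0,1]` which vanishes to order `n` at `x₀` is small near `x₀`. -/
theorem norm_iteratedDeriv_le_of_zero (hn : 1 < n) (y : dirichletSobolev n) {x₀ : ℝ}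
    (h : ∀ i < n, iteratedDeriv i (y : ℝ → ℂ) x₀ = 0) {j : ℕ} (hj : j < n) (x : ℝ) :
    ‖iteratedDeriv (n - 1 - j) (y : ℝ → ℂ) x‖ ≤
      |x - x₀| ^ j * √|x - x₀| * ‖topDeriv n hn y‖ := by
  have hp : ∀ j < n, iteratedPrimitive (topDeriv n hn y) j x₀ = 0 := fun j hj => by
    rw [iteratedPrimitive_topDeriv hn y hj, h _ (by omega)]
  rw [← iteratedPrimitive_topDeriv hn y hj]
  refine norm_le_of_iterated_primitive (topDeriv n hn y) (J := n - 1)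
    (F := fun j => iteratedPrimitive (topDeriv n hn y) j) (fun x => ?_) (fun j hj x => ?_) j
    (by omega) x
  · have h1 := hp 0 (by omega)
    simp only [iteratedPrimitive] at h1 ⊢
    rw [← intervalIntegral.integral_add_adjacent_intervals (integrable_coeFn_Lp _ 0 x₀)
      (integrable_coeFn_Lp _ x₀ x), h1, zero_add]
  · have h1 := hp (j + 1) (by omega)
    have hc := (contDiff_iteratedPrimitive (topDeriv n hn y) j).continuous
    simp only [iteratedPrimitive] at h1 ⊢
    rw [← intervalIntegral.integral_add_adjacent_intervals (hc.intervalIntegrable 0 x₀)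
      (hc.intervalIntegrable x₀ x), h1, zero_add]

theorem norm_iteratedDeriv_le (hn : 1 < n) (y : dirichletSobolev n) {i : ℕ} (hi : i < n) {x : ℝ}
    (hx : x ∈ Icc (0 : ℝ) 1) : ‖iteratedDeriv i (y : ℝ → ℂ) x‖ ≤ ‖topDeriv n hn y‖ := by
  have h := norm_iteratedDeriv_le_of_zero hn y (x₀ := 0) (fun i hi =>
    iteratedDeriv_eq_zero_of_notMem_Ioo y.2 (by omega) fun h => h.1.false)
    (j := n - 1 - i) (by omega) x
  rw [show n - 1 - (n - 1 - i) = i by omega, sub_zero, abs_of_nonneg hx.1] at h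
  refine h.trans (mul_le_of_le_one_left (norm_nonneg _) ?_)
  exact mul_le_one₀ (pow_le_one₀ hx.1 hx.2) (Real.sqrt_nonneg _) (Real.sqrt_le_one.2 hx.2)

end Sobolev

section JumpExpansion

/-! ### The partition -/

theorem knot_zero (a : ℕ → ℝ) : knot a 0 = 0 := by simp [knot]

theorem knot_succ (a : ℕ → ℝ) (k : ℕ) : knot a (k + 1) = knot a k + a (k + 1) := by
  simp [knot, Finset.sum_Icc_succ_top]

variable {N m : ℕ} {a β d : ℕ → ℝ} {P : ℝ → ℝ}

theorem IsSelfSimilar.knot_top (hP : IsSelfSimilar N a β d P) : knot a N = 1 := hP.sum_eq_one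

theorem IsSelfSimilar.knot_lt (hP : IsSelfSimilar N a β d P) {j k : ℕ} (hjk : j < k)
    (hk : k ≤ N) : knot a j < knot a k := by
  induction k, hjk using Nat.le_induction with
  | base =>
    rw [knot_succ]
    linarith [hP.pos (j + 1) (Finset.mem_Icc.2 ⟨by omega, hk⟩)]
  | succ k hjk ih =>
    have := ih (by omega)
    rw [knot_succ]
    linarith [hP.pos (k + 1) (Finset.mem_Icc.2 ⟨by omega, hk⟩)]

theorem IsSelfSimilar.knot_le (hP : IsSelfSimilar N a β d P) {j k : ℕ} (hjk : j ≤ k)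
    (hk : k ≤ N) : knot a j ≤ knot a k := by
  rcases hjk.eq_or_lt with rfl | h
  · exact le_rfl
  · exact (hP.knot_lt h hk).le

theorem IsSelfSimilar.knot_mem_Icc (hP : IsSelfSimilar N a β d P) {k : ℕ} (hk : k ≤ N) :
    knot a k ∈ Icc (0 : ℝ) 1 :=
  ⟨knot_zero a ▸ hP.knot_le (Nat.zero_le k) hk, hP.knot_top ▸ hP.knot_le hk le_rfl⟩

theorem IsSelfSimilar.knot_mem_Ioo (hP : IsSelfSimilar N a β d P) {k : ℕ}
    (hk : k ∈ Finset.Icc 1 (N - 1)) : knot a k ∈ Ioo (0 : ℝ) 1 := by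
  have hN := hP.one_lt
  rw [Finset.mem_Icc] at hk
  exact ⟨knot_zero a ▸ hP.knot_lt (by omega) (by omega), hP.knot_top ▸ hP.knot_lt (by omega) le_rfl⟩

theorem IsSelfSimilar.ae_eq_on_piece (hP : IsSelfSimilar N a β d P) {k : ℕ} (hk : k < N) :
    ∀ᵐ x, x ∈ Ioo (knot a k) (knot a (k + 1)) →
      P x = β (k + 1) + d (k + 1) * P ((x - knot a k) / a (k + 1)) := by
  filter_upwards [(ae_restrict_iff' measurableSet_Icc).1 hP.fixed] with x hx hxk
  have h0 := (hP.knot_mem_Icc hk.le).1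
  have h1 := (hP.knot_mem_Icc (k := k + 1) hk).2
  rw [← hx ⟨by linarith [hxk.1], by linarith [hxk.2]⟩, similarityOp,
    Finset.sum_eq_single_of_mem (k + 1) (Finset.mem_Icc.2 ⟨by omega, hk⟩) fun j hj hjk => ?_]
  · exact indicator_of_mem hxk _
  · refine indicator_of_notMem (fun hxj => ?_) _
    rw [Finset.mem_Icc] at hj
    rcases lt_or_gt_of_ne hjk with h | h
    · have := hP.knot_le (show j ≤ k by omega) hk.le
      linarith [hxk.1, hxj.2]
    · have := hP.knot_le (show k + 1 ≤ j - 1 by omega) (by omega)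
      linarith [hxk.2, hxj.1]

theorem IsSelfSimilar.intervalIntegrable (hP : IsSelfSimilar N a β d P) :
    IntervalIntegrable (fun x => (P x : ℂ)) volume 0 1 := by
  rw [intervalIntegrable_iff_integrableOn_Icc_of_le zero_le_one]
  exact (hP.memLp.integrable (by norm_num)).ofReal

theorem IsSelfSimilar.intervalIntegrable_mul (hP : IsSelfSimilar N a β d P) {g : ℝ → ℂ}
    (hg : Continuous g) {x y : ℝ} (hx : x ∈ Icc (0 : ℝ) 1) (hy : y ∈ Icc (0 : ℝ) 1) :
    IntervalIntegrable (fun x => (P x : ℂ) * g x) volume x y := by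
  refine (hP.intervalIntegrable.mul_continuousOn hg.continuousOn).mono_set ?_
  rw [uIcc_of_le zero_le_one]
  exact (convex_Icc (0 : ℝ) 1).ordConnected.uIcc_subset hx hy

/-- The affine map of `[0,1]` onto the `m`-th interval of the partition. -/
def contraction (a : ℕ → ℝ) (m : ℕ) (t : ℝ) : ℝ := knot a (m - 1) + a m * t

theorem contDiff_contraction (a : ℕ → ℝ) (m : ℕ) {r : WithTop ℕ∞} :
    ContDiff ℝ r (contraction a m) :=
  contDiff_const.add (contDiff_const.mul contDiff_id)

theorem deriv_comp_contraction {f : ℝ → ℂ} (hf : ContDiff ℝ 1 f) (t : ℝ) :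
    deriv (f ∘ contraction a m) t = a m * deriv f (contraction a m t) := by
  have h1 : HasDerivAt (contraction a m) (a m) t := by
    have h : HasDerivAt (contraction a m) (a m * 1) t :=
      ((hasDerivAt_id t).const_mul (a m)).const_add (knot a (m - 1))
    rwa [mul_one] at h
  have h2 := (hf.differentiable one_ne_zero (contraction a m t)).hasDerivAt.scomp t h1
  rw [h2.deriv]
  simp

theorem IsSelfSimilar.integral_piece (hP : IsSelfSimilar N a β d P) {k : ℕ} (hk : k < N)
    {f : ℝ → ℂ} (hf : ContDiff ℝ 1 f) :
    ∫ x in knot a k..knot a (k + 1), (P x : ℂ) * deriv f x =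
      β (k + 1) * (f (knot a (k + 1)) - f (knot a k)) +
        d (k + 1) * ∫ x in (0 : ℝ)..1, (P x : ℂ) * deriv (f ∘ contraction a (k + 1)) x := by
  have hc := hf.continuous_deriv le_rfl
  have hpos := hP.pos (k + 1) (Finset.mem_Icc.2 ⟨by omega, hk⟩)
  have hlt := hP.knot_lt (Nat.lt_succ_self k) hk
  have h1 : ∫ x in knot a k..knot a (k + 1), ((P x : ℂ) * deriv f x - β (k + 1) * deriv f x) =
      ∫ x in knot a k..knot a (k + 1),
        d (k + 1) * ((P ((x - knot a k) / a (k + 1)) : ℂ) * deriv f x) := by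
    refine intervalIntegral.integral_congr_ae ?_
    filter_upwards [hP.ae_eq_on_piece hk,
      measure_eq_zero_iff_ae_notMem.1 (measure_singleton (knot a (k + 1)))] with x hx hne hxk
    rw [uIoc_of_le hlt.le] at hxk
    rw [hx ⟨hxk.1, lt_of_le_of_ne hxk.2 hne⟩]
    push_cast
    ring
  have h2 : ∫ x in knot a k..knot a (k + 1), deriv f x = f (knot a (k + 1)) - f (knot a k) :=
    intervalIntegral.integral_deriv_eq_sub (fun x _ => hf.differentiable one_ne_zero x)
      (hc.intervalIntegrable _ _)
  rw [intervalIntegral.integral_sub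
    (hP.intervalIntegrable_mul hc (hP.knot_mem_Icc hk.le) (hP.knot_mem_Icc hk))
    ((hc.intervalIntegrable _ _).const_mul _), intervalIntegral.integral_const_mul,
    intervalIntegral.integral_const_mul, h2] at h1
  have h3 := intervalIntegral.smul_integral_comp_add_mul (a := 0) (b := 1)
    (fun x => (P ((x - knot a k) / a (k + 1)) : ℂ) * deriv f x) (a (k + 1)) (knot a k)
  rw [mul_zero, add_zero, mul_one, ← knot_succ, ← intervalIntegral.integral_smul] at h3
  rw [sub_eq_iff_eq_add'.1 h1, ← h3]
  congr 3
  funext x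
  rw [deriv_comp_contraction hf, contraction, Nat.add_sub_cancel, add_sub_cancel_left,
    mul_div_cancel_left₀ _ hpos.ne', Complex.real_smul]
  ring

/-! ### The functional `P'` and its expansion into point masses -/

/-- The functional `f ↦ -∫₀¹ P f' dx`, corrected by boundary terms. -/
def boundaryFunctional (N : ℕ) (β : ℕ → ℝ) (P : ℝ → ℝ) (f : ℝ → ℂ) : ℂ :=
  -(∫ x in (0 : ℝ)..1, (P x : ℂ) * deriv f x) + β N * f 1 - β 1 * f 0

theorem sum_mul_sub_eq (b F : ℕ → ℂ) {N : ℕ} (hN : 1 ≤ N) :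
    ∑ k ∈ Finset.range N, b (k + 1) * (F (k + 1) - F k) =
      b N * F N - b 1 * F 0 - ∑ k ∈ Finset.Icc 1 (N - 1), (b (k + 1) - b k) * F k := by
  induction N, hN using Nat.le_induction with
  | base => simp; ring
  | succ N hN ih =>
    obtain ⟨M, rfl⟩ : ∃ M, N = M + 1 := ⟨N - 1, by omega⟩
    rw [Finset.sum_range_succ, ih, Nat.add_sub_cancel, Nat.add_sub_cancel,
      Finset.sum_Icc_succ_top (by omega)]
    ring

theorem zeta_eq (N m : ℕ) (β d : ℕ → ℝ) (k : ℕ) (hm : k = m → k + 1 ≠ m) :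
    zeta N m β d k = (β (k + 1) - β k) + (if k + 1 = m then d m * β 1 else 0) -
      if k = m then d m * β N else 0 := by
  unfold zeta
  by_cases h1 : k + 1 = m
  · have h2 : k ≠ m := fun h => hm h h1
    simp only [h1, h2, if_true, if_false]
    rw [← h1, Nat.add_sub_cancel]
    ring
  · by_cases h2 : k = m
    · subst h2
      simp
    · simp [h1, h2]

theorem sum_zeta_mul (N m : ℕ) (β d : ℕ → ℝ) (F : ℕ → ℂ) (hm : m ∈ Finset.Icc 1 N)
    (h0 : m = 1 → F 0 = 0) (hN : m = N → F N = 0) :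
    ∑ k ∈ Finset.Icc 1 (N - 1), (zeta N m β d k : ℂ) * F k =
      ∑ k ∈ Finset.Icc 1 (N - 1), ((β (k + 1) : ℂ) - β k) * F k +
        d m * β 1 * F (m - 1) - d m * β N * F m := by
  rw [Finset.mem_Icc] at hm
  have e1 : ∑ k ∈ Finset.Icc 1 (N - 1), (if k = m - 1 then (d m * β 1 : ℂ) * F k else 0) =
      d m * β 1 * F (m - 1) := by
    rw [Finset.sum_ite_eq']
    split_ifs with h
    · rfl
    · rw [Finset.mem_Icc] at h
      rw [show m - 1 = 0 by omega, h0 (by omega), mul_zero]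
  have e2 : ∑ k ∈ Finset.Icc 1 (N - 1), (if k = m then (d m * β N : ℂ) * F k else 0) =
      d m * β N * F m := by
    rw [Finset.sum_ite_eq']
    split_ifs with h
    · rfl
    · rw [Finset.mem_Icc] at h
      have : m = N := by omega
      rw [this, hN this, mul_zero]
  rw [← e1, ← e2, ← Finset.sum_add_distrib, ← Finset.sum_sub_distrib]
  refine Finset.sum_congr rfl fun k hk => ?_
  rw [zeta_eq N m β d k (by omega)]
  have : k + 1 = m ↔ k = m - 1 := by omega
  simp only [this]
  split_ifs <;> push_cast <;> ring

theorem contraction_zero (a : ℕ → ℝ) (m : ℕ) : contraction a m 0 = knot a (m - 1) := by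
  simp [contraction]

theorem contraction_one (a : ℕ → ℝ) {m : ℕ} (hm : 1 ≤ m) : contraction a m 1 = knot a m := by
  obtain ⟨k, rfl⟩ : ∃ k, m = k + 1 := ⟨m - 1, by omega⟩
  rw [contraction, knot_succ, Nat.add_sub_cancel, mul_one]

theorem IsZeroSpectralOrder.boundaryFunctional_eq (hP : IsZeroSpectralOrder N m a β d P)
    {f : ℝ → ℂ} (hf : ContDiff ℝ 1 f) (h0 : m = 1 → f 0 = 0) (h1 : m = N → f 1 = 0) :
    boundaryFunctional N β P f = ∑ k ∈ Finset.Icc 1 (N - 1), (zeta N m β d k : ℂ) * f (knot a k) +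
      d m * boundaryFunctional N β P (f ∘ contraction a m) := by
  have hS := hP.toIsSelfSimilar
  have hN := hS.one_lt
  have hm := Finset.mem_Icc.1 hP.mem
  have hc := hf.continuous_deriv le_rfl
  have hsum : ∫ x in (0 : ℝ)..1, (P x : ℂ) * deriv f x =
      ∑ k ∈ Finset.range N, (β (k + 1) : ℂ) * (f (knot a (k + 1)) - f (knot a k)) +
        d m * ∫ x in (0 : ℝ)..1, (P x : ℂ) * deriv (f ∘ contraction a m) x := by
    have h := intervalIntegral.sum_integral_adjacent_intervals (a := knot a) (n := N)
      (f := fun x => (P x : ℂ) * deriv f x) (μ := volume) fun k hk =>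
        hS.intervalIntegrable_mul hc (hS.knot_mem_Icc hk.le) (hS.knot_mem_Icc hk)
    rw [knot_zero, hS.knot_top] at h
    rw [← h, Finset.sum_congr rfl fun k hk => hS.integral_piece (Finset.mem_range.1 hk) hf,
      Finset.sum_add_distrib]
    congr 1
    rw [Finset.sum_eq_single_of_mem (m - 1) (Finset.mem_range.2 (by omega)) fun k hk hkm => ?_,
      Nat.sub_add_cancel hm.1]
    have hd : d (k + 1) = 0 := by
      by_contra hne
      have := (hP.ne_zero_iff (k + 1)
        (Finset.mem_Icc.2 ⟨by omega, Finset.mem_range.1 hk⟩)).1 hne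
      omega
    rw [hd, Complex.ofReal_zero, zero_mul]
  rw [sum_zeta_mul N m β d (fun k => f (knot a k)) hP.mem
    (fun h => by simpa only [knot_zero] using h0 h) (fun h => by simpa only [hS.knot_top] using h1 h)]
  have habel := sum_mul_sub_eq (fun k => (β k : ℂ)) (fun k => f (knot a k)) (N := N) (by omega)
  simp only [boundaryFunctional, hsum, Function.comp_apply, contraction_zero,
    contraction_one a hm.1]
  rw [knot_zero, hS.knot_top] at habel
  rw [habel]
  ring

theorem contDiff_iterate_contraction (a : ℕ → ℝ) (m : ℕ) {r : WithTop ℕ∞} (J : ℕ) :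
    ContDiff ℝ r (contraction a m)^[J] := by
  induction J with
  | zero => exact contDiff_id
  | succ J ih => exact ih.comp (contDiff_contraction a m)

theorem IsZeroSpectralOrder.iterate_contraction_zero (hm : m = 1) (J : ℕ) :
    (contraction a m)^[J] 0 = 0 :=
  Function.iterate_fixed (by rw [contraction_zero, hm, knot_zero]) J

theorem IsZeroSpectralOrder.iterate_contraction_one (hP : IsZeroSpectralOrder N m a β d P)
    (hm : m = N) (J : ℕ) : (contraction a m)^[J] 1 = 1 :=
  Function.iterate_fixed (by
    rw [contraction_one a (Finset.mem_Icc.1 hP.mem).1, hm, hP.toIsSelfSimilar.knot_top]) J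

theorem IsZeroSpectralOrder.boundaryFunctional_iterate (hP : IsZeroSpectralOrder N m a β d P)
    {f : ℝ → ℂ} (hf : ContDiff ℝ 1 f) (h0 : m = 1 → f 0 = 0) (h1 : m = N → f 1 = 0) (J : ℕ) :
    boundaryFunctional N β P f = ∑ j ∈ Finset.range J, (d m : ℂ) ^ j *
      ∑ k ∈ Finset.Icc 1 (N - 1), (zeta N m β d k : ℂ) * f ((contraction a m)^[j] (knot a k)) +
      (d m : ℂ) ^ J * boundaryFunctional N β P (f ∘ (contraction a m)^[J]) := by
  induction J with
  | zero => simp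
  | succ J ih =>
    rw [ih, hP.boundaryFunctional_eq (hf.comp (contDiff_iterate_contraction a m J))
      (fun h => by rw [Function.comp_apply, iterate_contraction_zero h, h0 h])
      (fun h => by rw [Function.comp_apply, hP.iterate_contraction_one h, h1 h]),
      Finset.sum_range_succ, Function.comp_assoc, ← Function.iterate_succ, pow_succ]
    simp only [Function.comp_apply]
    ring

/-- A bound for the norm of `boundaryFunctional`. -/
def boundaryConst (N : ℕ) (β : ℕ → ℝ) (P : ℝ → ℝ) : ℝ :=
  (∫ x in (0 : ℝ)..1, ‖(P x : ℂ)‖) + |β N| + |β 1|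

theorem boundaryConst_nonneg (N : ℕ) (β : ℕ → ℝ) (P : ℝ → ℝ) : 0 ≤ boundaryConst N β P := by
  have : 0 ≤ ∫ x in (0 : ℝ)..1, ‖(P x : ℂ)‖ :=
    intervalIntegral.integral_nonneg zero_le_one fun _ _ => norm_nonneg _
  unfold boundaryConst
  positivity

theorem IsSelfSimilar.norm_integral_mul_le (hP : IsSelfSimilar N a β d P) {g : ℝ → ℂ} {M : ℝ}
    (hg : ∀ x ∈ Icc (0 : ℝ) 1, ‖g x‖ ≤ M) :
    ‖∫ x in (0 : ℝ)..1, (P x : ℂ) * g x‖ ≤ (∫ x in (0 : ℝ)..1, ‖(P x : ℂ)‖) * M := by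
  rw [← intervalIntegral.integral_mul_const]
  refine intervalIntegral.norm_integral_le_of_norm_le zero_le_one
    (Eventually.of_forall fun x hx => ?_) (hP.intervalIntegrable.norm.mul_const M)
  rw [norm_mul]
  exact mul_le_mul_of_nonneg_left (hg x (Ioc_subset_Icc_self hx)) (norm_nonneg _)

theorem IsSelfSimilar.norm_boundaryFunctional_le (hP : IsSelfSimilar N a β d P) {f : ℝ → ℂ}
    {M : ℝ} (hf : ∀ x ∈ Icc (0 : ℝ) 1, ‖deriv f x‖ ≤ M) (h0 : ‖f 0‖ ≤ M) (h1 : ‖f 1‖ ≤ M) :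
    ‖boundaryFunctional N β P f‖ ≤ boundaryConst N β P * M := by
  unfold boundaryFunctional boundaryConst
  refine (norm_sub_le _ _).trans ?_
  refine (add_le_add_left (norm_add_le _ _) _).trans ?_
  rw [norm_neg, norm_mul, norm_mul, Complex.norm_real, Complex.norm_real, add_mul, add_mul]
  refine add_le_add (add_le_add (hP.norm_integral_mul_le hf) ?_) ?_
  · exact mul_le_mul_of_nonneg_left h1 (abs_nonneg _)
  · exact mul_le_mul_of_nonneg_left h0 (abs_nonneg _)

/-! ### The contraction and its fixed point -/

theorem IsZeroSpectralOrder.length_pos (hP : IsZeroSpectralOrder N m a β d P) : 0 < a m :=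
  hP.pos m hP.mem

theorem IsZeroSpectralOrder.knot_sub (hP : IsZeroSpectralOrder N m a β d P) :
    knot a m = knot a (m - 1) + a m := by
  rw [← contraction_one a (Finset.mem_Icc.1 hP.mem).1, contraction, mul_one]

theorem IsZeroSpectralOrder.length_lt_one (hP : IsZeroSpectralOrder N m a β d P) : a m < 1 := by
  have hm := Finset.mem_Icc.1 hP.mem
  have hN := hP.one_lt
  have hS := hP.toIsSelfSimilar
  have h1 := hP.knot_sub
  rcases hm.1.eq_or_lt with h | h
  · have h2 := hS.knot_lt (show m < N by omega) le_rfl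
    have h3 := (hS.knot_mem_Icc (show m - 1 ≤ N by omega)).1
    linarith [hS.knot_top]
  · have h2 := hS.knot_lt (show 0 < m - 1 by omega) (by omega)
    have h3 := (hS.knot_mem_Icc hm.2).2
    linarith [knot_zero a]

theorem IsZeroSpectralOrder.contraction_mem_Icc (hP : IsZeroSpectralOrder N m a β d P) {t : ℝ}
    (ht : t ∈ Icc (0 : ℝ) 1) : contraction a m t ∈ Icc (knot a (m - 1)) (knot a m) := by
  have h := hP.length_pos
  rw [hP.knot_sub]
  refine ⟨?_, ?_⟩ <;> unfold contraction <;> nlinarith [ht.1, ht.2]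

/-- The fixed point of the contraction. -/
def fixedPoint (a : ℕ → ℝ) (m : ℕ) : ℝ := knot a (m - 1) / (1 - a m)

theorem IsZeroSpectralOrder.fixedPoint_mem (hP : IsZeroSpectralOrder N m a β d P) :
    fixedPoint a m ∈ Icc (0 : ℝ) 1 := by
  have hm := Finset.mem_Icc.1 hP.mem
  have h1 := hP.length_lt_one
  have h2 := hP.toIsSelfSimilar.knot_mem_Icc (show m - 1 ≤ N by omega)
  have h3 := (hP.toIsSelfSimilar.knot_mem_Icc hm.2).2
  rw [hP.knot_sub] at h3
  unfold fixedPoint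
  exact ⟨div_nonneg h2.1 (by linarith), (div_le_one (by linarith)).2 (by linarith)⟩

theorem IsZeroSpectralOrder.iterate_contraction_sub (hP : IsZeroSpectralOrder N m a β d P)
    (J : ℕ) (t : ℝ) :
    (contraction a m)^[J] t = fixedPoint a m + a m ^ J * (t - fixedPoint a m) := by
  have h1 : 1 - a m ≠ 0 := by linarith [hP.length_lt_one]
  have hx : knot a (m - 1) = fixedPoint a m * (1 - a m) := by
    unfold fixedPoint
    field_simp
  induction J with
  | zero => simp
  | succ J ih =>
    rw [Function.iterate_succ_apply', ih, contraction, hx, pow_succ]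
    ring

theorem IsZeroSpectralOrder.abs_iterate_sub_le (hP : IsZeroSpectralOrder N m a β d P)
    {t : ℝ} (ht : t ∈ Icc (0 : ℝ) 1) (J : ℕ) :
    |(contraction a m)^[J] t - fixedPoint a m| ≤ a m ^ J := by
  have h := hP.fixedPoint_mem
  have h0 := hP.length_pos
  rw [hP.iterate_contraction_sub, add_sub_cancel_left, abs_mul, abs_of_pos (pow_pos h0 J)]
  exact mul_le_of_le_one_right (by positivity)
    (abs_sub_le_iff.2 ⟨by linarith [ht.2, h.1], by linarith [ht.1, h.2]⟩)

theorem IsZeroSpectralOrder.deriv_comp_iterate (hP : IsZeroSpectralOrder N m a β d P)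
    {f : ℝ → ℂ} (hf : ContDiff ℝ 1 f) (J : ℕ) (t : ℝ) :
    deriv (f ∘ (contraction a m)^[J]) t = a m ^ J * deriv f ((contraction a m)^[J] t) := by
  have h1 : HasDerivAt (contraction a m)^[J] (a m ^ J) t := by
    rw [funext (hP.iterate_contraction_sub J)]
    simpa using (((hasDerivAt_id t).sub_const (fixedPoint a m)).const_mul (a m ^ J)).const_add
      (fixedPoint a m)
  have h2 := (hf.differentiable one_ne_zero ((contraction a m)^[J] t)).hasDerivAt.scomp t h1
  rw [h2.deriv]
  simp

theorem IsZeroSpectralOrder.ratio_lt_one (hP : IsZeroSpectralOrder N m a β d P) (hd : 0 < d m)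
    {n : ℕ} (hn : 1 < n) : a m ^ (2 * n - 1) * d m < 1 := by
  have h0 := hP.length_pos
  have h1 : a m * |d m| ^ 2 < 1 := lt_of_le_of_lt (Finset.single_le_sum
    (f := fun k => a k * |d k| ^ 2) (fun k hk => mul_nonneg (hP.pos k hk).le (sq_nonneg _))
    hP.mem) hP.contractive
  rw [sq_abs] at h1
  have h2 : (a m ^ (2 * n - 1) * d m) ^ 2 = a m ^ (4 * n - 3) * (a m * d m ^ 2) := by
    rw [mul_pow, ← pow_mul, ← mul_assoc, ← pow_succ]
    congr 2
    omega
  have h3 : a m ^ (4 * n - 3) ≤ 1 := pow_le_one₀ h0.le hP.length_lt_one.le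
  have h4 : (a m ^ (2 * n - 1) * d m) ^ 2 < 1 := by
    rw [h2]
    exact lt_of_le_of_lt (mul_le_of_le_one_left (by positivity) h3) h1
  exact (sq_lt_one_iff₀ (by positivity)).1 h4

end JumpExpansion

section WeightOperator

variable {n : ℕ} {P : ℝ → ℝ}

/-! ### The quadratic form of the weight -/

/-- The sesquilinear form `⟨P', y conj z⟩`. -/
def weightForm (P : ℝ → ℝ) (y z : ℝ → ℂ) : ℂ :=
  -∫ x in (0 : ℝ)..1, (P x : ℂ) * deriv (fun t => y t * conj (z t)) x

theorem deriv_mul_conj (hn : 1 < n) {y z : ℝ → ℂ} (hy : y ∈ dirichletSobolev n)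
    (hz : z ∈ dirichletSobolev n) (x : ℝ) : deriv (fun t => y t * conj (z t)) x =
      deriv y x * conj (z x) + y x * conj (deriv z x) := by
  have h1 := ((contDiff_one hn hy).differentiable one_ne_zero x).hasDerivAt
  have h2 := ((contDiff_one hn hz).differentiable one_ne_zero x).hasDerivAt
  exact (h1.mul h2.star).deriv

theorem intervalIntegrable_weight (hn : 1 < n) (hP : MemLp P 2 unitMeasure) {y z : ℝ → ℂ}
    (hy : y ∈ dirichletSobolev n) (hz : z ∈ dirichletSobolev n) :
    IntervalIntegrable (fun x => (P x : ℂ) * deriv (fun t => y t * conj (z t)) x) volume 0 1 := by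
  have h : IntervalIntegrable (fun x => (P x : ℂ)) volume 0 1 := by
    rw [intervalIntegrable_iff_integrableOn_Icc_of_le zero_le_one]
    exact (hP.integrable (by norm_num)).ofReal
  exact h.mul_continuousOn ((contDiff_mul_conj hn hy hz).continuous_deriv le_rfl).continuousOn

theorem weightForm_add_left (hn : 1 < n) (hP : MemLp P 2 unitMeasure) {y₁ y₂ z : ℝ → ℂ}
    (h₁ : y₁ ∈ dirichletSobolev n) (h₂ : y₂ ∈ dirichletSobolev n) (hz : z ∈ dirichletSobolev n) :
    weightForm P (y₁ + y₂) z = weightForm P y₁ z + weightForm P y₂ z := by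
  unfold weightForm
  rw [← neg_add, ← intervalIntegral.integral_add (intervalIntegrable_weight hn hP h₁ hz)
    (intervalIntegrable_weight hn hP h₂ hz)]
  congr 2
  funext x
  rw [deriv_mul_conj hn (add_mem h₁ h₂) hz, deriv_mul_conj hn h₁ hz, deriv_mul_conj hn h₂ hz,
    deriv_add ((contDiff_one hn h₁).differentiable one_ne_zero x)
      ((contDiff_one hn h₂).differentiable one_ne_zero x), Pi.add_apply]
  ring

theorem weightForm_smul_left (hn : 1 < n) (c : ℂ) {y z : ℝ → ℂ} (hy : y ∈ dirichletSobolev n)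
    (hz : z ∈ dirichletSobolev n) : weightForm P (c • y) z = c * weightForm P y z := by
  unfold weightForm
  rw [mul_neg, ← intervalIntegral.integral_const_mul]
  congr 2
  funext x
  rw [deriv_mul_conj hn (Submodule.smul_mem _ c hy) hz, deriv_mul_conj hn hy hz,
    deriv_const_smul c ((contDiff_one hn hy).differentiable one_ne_zero x), Pi.smul_apply,
    smul_eq_mul, smul_eq_mul]
  ring

theorem conj_weightForm (hn : 1 < n) {y z : ℝ → ℂ} (hy : y ∈ dirichletSobolev n)
    (hz : z ∈ dirichletSobolev n) : conj (weightForm P y z) = weightForm P z y := by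
  unfold weightForm
  rw [map_neg, ← intervalIntegral.intervalIntegral_conj]
  congr 2
  funext x
  rw [deriv_mul_conj hn hy hz, deriv_mul_conj hn hz hy]
  simp only [map_mul, map_add, Complex.conj_ofReal, Complex.conj_conj]
  ring

theorem norm_weightForm_le (hn : 1 < n) (hP : MemLp P 2 unitMeasure) (y z : dirichletSobolev n) :
    ‖weightForm P y z‖ ≤
      2 * (∫ x in (0 : ℝ)..1, ‖(P x : ℂ)‖) * ‖topDeriv n hn y‖ * ‖topDeriv n hn z‖ := by
  have h : IntervalIntegrable (fun x => (P x : ℂ)) volume 0 1 := by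
    rw [intervalIntegrable_iff_integrableOn_Icc_of_le zero_le_one]
    exact (hP.integrable (by norm_num)).ofReal
  have hb : ∀ (u : dirichletSobolev n) (x : ℝ), x ∈ Icc (0 : ℝ) 1 →
      ‖(u : ℝ → ℂ) x‖ ≤ ‖topDeriv n hn u‖ ∧ ‖deriv (u : ℝ → ℂ) x‖ ≤ ‖topDeriv n hn u‖ := by
    intro u x hx
    have h0 := norm_iteratedDeriv_le hn u (i := 0) (by omega) hx
    have h1 := norm_iteratedDeriv_le hn u (i := 1) hn hx
    rw [iteratedDeriv_zero] at h0
    rw [iteratedDeriv_one] at h1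
    exact ⟨h0, h1⟩
  unfold weightForm
  rw [norm_neg]
  calc _ ≤ ∫ x in (0 : ℝ)..1, ‖(P x : ℂ)‖ * (2 * ‖topDeriv n hn y‖ * ‖topDeriv n hn z‖) := by
        refine intervalIntegral.norm_integral_le_of_norm_le zero_le_one
          (Eventually.of_forall fun x hx => ?_) (h.norm.mul_const _)
        have hx' := Ioc_subset_Icc_self hx
        rw [norm_mul, deriv_mul_conj hn y.2 z.2]
        refine mul_le_mul_of_nonneg_left ((norm_add_le _ _).trans ?_) (norm_nonneg _)
        rw [norm_mul, norm_mul, RCLike.norm_conj, RCLike.norm_conj]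
        have h1 := mul_le_mul (hb y x hx').2 (hb z x hx').1 (norm_nonneg _) (norm_nonneg _)
        have h2 := mul_le_mul (hb y x hx').1 (hb z x hx').2 (norm_nonneg _) (norm_nonneg _)
        linarith
    _ = _ := by
        rw [intervalIntegral.integral_mul_const]
        ring

/-- The sesquilinear form of the weight on the energy space. -/
def weightBilin (n : ℕ) (hn : 1 < n) (P : ℝ → ℝ) (hP : MemLp P 2 unitMeasure) :
    energySpace n hn →L⋆[ℂ] energySpace n hn →L[ℂ] ℂ :=
  LinearMap.mkContinuous₂
    (LinearMap.mk₂'ₛₗ (starRingEnd ℂ) (RingHom.id ℂ)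
      (fun v w => weightForm P ((energyEquiv n hn).symm w : ℝ → ℂ) ((energyEquiv n hn).symm v))
      (fun v₁ v₂ w => by
        rw [← conj_weightForm hn (Subtype.mem _) (Subtype.mem _), map_add, Submodule.coe_add,
          weightForm_add_left hn hP (Subtype.mem _) (Subtype.mem _) (Subtype.mem _), map_add,
          conj_weightForm hn (Subtype.mem _) (Subtype.mem _),
          conj_weightForm hn (Subtype.mem _) (Subtype.mem _)])
      (fun c v w => by
        rw [← conj_weightForm hn (Subtype.mem _) (Subtype.mem _), map_smul, Submodule.coe_smul,
          weightForm_smul_left hn c (Subtype.mem _) (Subtype.mem _), map_mul,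
          conj_weightForm hn (Subtype.mem _) (Subtype.mem _), smul_eq_mul])
      (fun v w₁ w₂ => by
        rw [map_add, Submodule.coe_add,
          weightForm_add_left hn hP (Subtype.mem _) (Subtype.mem _) (Subtype.mem _)])
      (fun c v w => by
        rw [map_smul, Submodule.coe_smul,
          weightForm_smul_left hn c (Subtype.mem _) (Subtype.mem _), RingHom.id_apply,
          smul_eq_mul]))
    (2 * ∫ x in (0 : ℝ)..1, ‖(P x : ℂ)‖) fun v w => by
      refine (norm_weightForm_le hn hP _ _).trans (le_of_eq ?_)
      rw [← norm_energyEquiv, ← norm_energyEquiv, LinearEquiv.apply_symm_apply,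
        LinearEquiv.apply_symm_apply]
      ring

/-- The operator of multiplication by the weight `P'` in the energy space. -/
def weightOperator (n : ℕ) (hn : 1 < n) (P : ℝ → ℝ) (hP : MemLp P 2 unitMeasure) :
    energySpace n hn →L[ℂ] energySpace n hn :=
  InnerProductSpace.continuousLinearMapOfBilin (weightBilin n hn P hP)

theorem inner_weightOperator (hn : 1 < n) (hP : MemLp P 2 unitMeasure) (y z : dirichletSobolev n) :
    inner ℂ (weightOperator n hn P hP (energyEquiv n hn y)) (energyEquiv n hn z) =
      weightForm P z y := by
  rw [weightOperator, InnerProductSpace.continuousLinearMapOfBilin_apply]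
  simp [weightBilin]

theorem weightOperator_isSymmetric (hn : 1 < n) (hP : MemLp P 2 unitMeasure) :
    (weightOperator n hn P hP : energySpace n hn →ₗ[ℂ] energySpace n hn).IsSymmetric := by
  intro v w
  obtain ⟨y, rfl⟩ := (energyEquiv n hn).surjective v
  obtain ⟨z, rfl⟩ := (energyEquiv n hn).surjective w
  change inner ℂ (weightOperator n hn P hP (energyEquiv n hn y)) (energyEquiv n hn z) =
    inner ℂ (energyEquiv n hn y) (weightOperator n hn P hP (energyEquiv n hn z))
  rw [← inner_conj_symm (energyEquiv n hn y), inner_weightOperator, inner_weightOperator,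
    conj_weightForm hn y.2 z.2]

/-! ### Eigenfunctions of the pencil -/

theorem inner_energyEquiv (hn : 1 < n) (y z : dirichletSobolev n) :
    inner ℂ (energyEquiv n hn z) (energyEquiv n hn y) =
      ∫ x in (0 : ℝ)..1, iteratedDeriv n (y : ℝ → ℂ) x * conj (iteratedDeriv n (z : ℝ → ℂ) x) := by
  change inner ℂ (topDeriv n hn z) (topDeriv n hn y) = _
  rw [L2.inner_def, intervalIntegral.integral_of_le zero_le_one, ← integral_Icc_eq_integral_Ioc,
    setIntegral_eq_integral_of_forall_compl_eq_zero fun x hx => by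
      rw [iteratedDeriv_eq_zero_of_notMem_Icc y.2 n hx, zero_mul]]
  refine integral_congr_ae ?_
  filter_upwards [coeFn_topDeriv hn y, coeFn_topDeriv hn z] with x hy hz
  rw [hy, hz, RCLike.inner_apply]

theorem pencilForm_eq (hn : 1 < n) (hP : MemLp P 2 unitMeasure) (lam : ℂ)
    (y z : dirichletSobolev n) : pencilForm n P lam y z =
      inner ℂ (energyEquiv n hn z) (energyEquiv n hn y) - lam * weightForm P y z := by
  have h1 : IntervalIntegrable (fun x => iteratedDeriv n (y : ℝ → ℂ) x *
      conj (iteratedDeriv n (z : ℝ → ℂ) x)) volume 0 1 := by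
    rw [intervalIntegrable_iff_integrableOn_Icc_of_le zero_le_one]
    exact (ae_hasDerivAt hn y.2).2.integrable_mul (ae_hasDerivAt hn z.2).2.star
  unfold pencilForm weightForm
  rw [intervalIntegral.integral_add h1 ((intervalIntegrable_weight hn hP y.2 z.2).const_mul lam),
    intervalIntegral.integral_const_mul, inner_energyEquiv]
  ring

theorem eigenspace_eq_map (hn : 1 < n) (hP : MemLp P 2 unitMeasure) {μ : ℝ} (hμ : 0 < μ) :
    eigenspace n hn P hP μ =
      (Module.End.eigenspace (weightOperator n hn P hP : energySpace n hn →ₗ[ℂ] energySpace n hn)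
        (μ : ℂ)⁻¹).map ((dirichletSobolev n).subtype.comp
          ((energyEquiv n hn).symm : energySpace n hn →ₗ[ℂ] dirichletSobolev n)) := by
  have hμ' : (μ : ℂ) ≠ 0 := Complex.ofReal_ne_zero.2 hμ.ne'
  have key : ∀ y : dirichletSobolev n, (∀ z ∈ dirichletSobolev n, pencilForm n P μ y z = 0) ↔
      weightOperator n hn P hP (energyEquiv n hn y) = (μ : ℂ)⁻¹ • energyEquiv n hn y := by
    intro y
    have h1 : ∀ z : dirichletSobolev n, pencilForm n P μ y z = inner ℂ (energyEquiv n hn z)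
        (energyEquiv n hn y - (μ : ℂ) • weightOperator n hn P hP (energyEquiv n hn y)) := by
      intro z
      have h2 : inner ℂ (energyEquiv n hn z)
          ((μ : ℂ) • weightOperator n hn P hP (energyEquiv n hn y)) = (μ : ℂ) *
          inner ℂ (energyEquiv n hn z) (weightOperator n hn P hP (energyEquiv n hn y)) :=
        inner_smul_right (E := energySpace n hn) _ _ _
      rw [pencilForm_eq hn hP, inner_sub_right, h2,
        ← inner_conj_symm _ (weightOperator n hn P hP _), inner_weightOperator,
        conj_weightForm hn z.2 y.2]
    have h2 : weightOperator n hn P hP (energyEquiv n hn y) = (μ : ℂ)⁻¹ • energyEquiv n hn y ↔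
        energyEquiv n hn y - (μ : ℂ) • weightOperator n hn P hP (energyEquiv n hn y) = 0 := by
      rw [sub_eq_zero, eq_inv_smul_iff₀ hμ', eq_comm]
    rw [h2]
    constructor
    · intro h
      refine ext_inner_left ℂ fun w => ?_
      obtain ⟨z, rfl⟩ := (energyEquiv n hn).surjective w
      rw [← h1, h z z.2, inner_zero_right]
    · intro h z hz
      rw [h1 ⟨z, hz⟩, h, inner_zero_right]
  ext y
  constructor
  · rintro ⟨hy, h⟩
    exact ⟨energyEquiv n hn ⟨y, hy⟩, Module.End.mem_eigenspace_iff.2 ((key ⟨y, hy⟩).1 h), by simp⟩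
  · rintro ⟨v, hv, rfl⟩
    obtain ⟨y, rfl⟩ := (energyEquiv n hn).surjective v
    simp only [LinearMap.comp_apply, LinearEquiv.coe_coe, LinearEquiv.symm_apply_apply,
      Submodule.subtype_apply]
    exact ⟨y.2, (key y).2 (Module.End.mem_eigenspace_iff.1 hv)⟩

/-- The solutions of the boundary value problem are the eigenvectors of the weight operator. -/
def eigenspaceEquiv (hn : 1 < n) (hP : MemLp P 2 unitMeasure) {μ : ℝ} (hμ : 0 < μ) :
    Module.End.eigenspace (weightOperator n hn P hP : energySpace n hn →ₗ[ℂ] energySpace n hn)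
      (μ : ℂ)⁻¹ ≃ₗ[ℂ] eigenspace n hn P hP μ :=
  (Submodule.equivMapOfInjective ((dirichletSobolev n).subtype.comp
      ((energyEquiv n hn).symm : energySpace n hn →ₗ[ℂ] dirichletSobolev n))
    ((dirichletSobolev n).injective_subtype.comp (energyEquiv n hn).symm.injective) _).trans
    (LinearEquiv.ofEq _ _ (eigenspace_eq_map hn hP hμ).symm)

end WeightOperator

section UpperBound

variable {n N m : ℕ} {a β d : ℕ → ℝ} {P : ℝ → ℝ}

theorem weightForm_eq_boundaryFunctional (N : ℕ) (β : ℕ → ℝ) {y : ℝ → ℂ}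
    (hy : y ∈ dirichletSobolev n) (z : ℝ → ℂ) :
    weightForm P y z = boundaryFunctional N β P (fun t => y t * conj (z t)) := by
  have h0 : y 0 = 0 := hy.1 0 fun h => h.1.false
  have h1 : y 1 = 0 := hy.1 1 fun h => h.2.false
  simp [weightForm, boundaryFunctional, h0, h1]

theorem IsZeroSpectralOrder.weightForm_self_eq (hP : IsZeroSpectralOrder N m a β d P)
    (hn : 1 < n) {y : ℝ → ℂ} (hy : y ∈ dirichletSobolev n) (J : ℕ) :
    weightForm P y y = ((∑ j ∈ Finset.range J, d m ^ j * ∑ k ∈ Finset.Icc 1 (N - 1),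
      zeta N m β d k * ‖y ((contraction a m)^[j] (knot a k))‖ ^ 2 : ℝ) : ℂ) +
      (d m : ℂ) ^ J *
        boundaryFunctional N β P ((fun t => y t * conj (y t)) ∘ (contraction a m)^[J]) := by
  have h0 : y 0 = 0 := hy.1 0 fun h => h.1.false
  have h1 : y 1 = 0 := hy.1 1 fun h => h.2.false
  rw [weightForm_eq_boundaryFunctional N β hy,
    hP.boundaryFunctional_iterate (contDiff_mul_conj hn hy hy) (fun _ => by simp [h0])
      (fun _ => by simp [h1]) J]
  push_cast
  simp only [Complex.mul_conj']

theorem IsZeroSpectralOrder.norm_remainder_le (hP : IsZeroSpectralOrder N m a β d P)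
    (hn : 1 < n) (y : dirichletSobolev n)
    (hy : ∀ i < n, iteratedDeriv i (y : ℝ → ℂ) (fixedPoint a m) = 0) (J : ℕ) :
    ‖boundaryFunctional N β P
        ((fun t => (y : ℝ → ℂ) t * conj ((y : ℝ → ℂ) t)) ∘ (contraction a m)^[J])‖ ≤
      boundaryConst N β P * (2 * (a m ^ (2 * n - 1)) ^ J * ‖topDeriv n hn y‖ ^ 2) := by
  obtain ⟨k, rfl⟩ : ∃ k, n = k + 2 := ⟨n - 2, by omega⟩
  have ha := hP.length_pos
  set E := ‖topDeriv (k + 2) hn y‖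
  have hE0 : 0 ≤ E := norm_nonneg _
  have hval : ∀ s, ‖(y : ℝ → ℂ) s‖ ≤
      |s - fixedPoint a m| ^ (k + 1) * √|s - fixedPoint a m| * E := by
    intro s
    have h := norm_iteratedDeriv_le_of_zero hn y hy (j := k + 1) (by omega) s
    rwa [show k + 2 - 1 - (k + 1) = 0 by omega, iteratedDeriv_zero] at h
  have hder : ∀ s, ‖deriv (y : ℝ → ℂ) s‖ ≤
      |s - fixedPoint a m| ^ k * √|s - fixedPoint a m| * E := by
    intro s
    have h := norm_iteratedDeriv_le_of_zero hn y hy (j := k) (by omega) s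
    rwa [show k + 2 - 1 - k = 1 by omega, iteratedDeriv_one] at h
  have hpow : (a m ^ (2 * (k + 2) - 1)) ^ J = (a m ^ J) ^ (2 * k + 3) := by
    rw [← pow_mul, ← pow_mul, mul_comm]
    congr 1
  have hend : ∀ t ∈ Icc (0 : ℝ) 1, ‖((fun t => (y : ℝ → ℂ) t * conj ((y : ℝ → ℂ) t)) ∘
      (contraction a m)^[J]) t‖ ≤ 2 * (a m ^ (2 * (k + 2) - 1)) ^ J * E ^ 2 := by
    intro t ht
    set s := (contraction a m)^[J] t
    have hδ := hP.abs_iterate_sub_le ht J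
    rw [Function.comp_apply, norm_mul, RCLike.norm_conj]
    calc _ ≤ (|s - fixedPoint a m| ^ (k + 1) * √|s - fixedPoint a m| * E) *
          (|s - fixedPoint a m| ^ (k + 1) * √|s - fixedPoint a m| * E) :=
          mul_le_mul (hval s) (hval s) (norm_nonneg _) (by positivity)
      _ = |s - fixedPoint a m| ^ (2 * k + 2) *
          (√|s - fixedPoint a m| * √|s - fixedPoint a m|) * E ^ 2 := by ring
      _ = |s - fixedPoint a m| ^ (2 * k + 3) * E ^ 2 := by
          rw [Real.mul_self_sqrt (abs_nonneg _)]
          ring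
      _ ≤ (a m ^ J) ^ (2 * k + 3) * E ^ 2 := by gcongr
      _ ≤ _ := by
          rw [hpow]
          nlinarith [show 0 ≤ (a m ^ J) ^ (2 * k + 3) * E ^ 2 by positivity]
  refine hP.toIsSelfSimilar.norm_boundaryFunctional_le (fun t ht => ?_)
    (hend 0 (left_mem_Icc.2 zero_le_one)) (hend 1 (right_mem_Icc.2 zero_le_one))
  rw [hP.deriv_comp_iterate (contDiff_mul_conj hn y.2 y.2)]
  set s := (contraction a m)^[J] t
  have hδ := hP.abs_iterate_sub_le ht J
  have h1 : ‖deriv (fun t => (y : ℝ → ℂ) t * conj ((y : ℝ → ℂ) t)) s‖ ≤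
      2 * (‖deriv (y : ℝ → ℂ) s‖ * ‖(y : ℝ → ℂ) s‖) := by
    rw [deriv_mul_conj hn y.2 y.2]
    refine (norm_add_le _ _).trans (le_of_eq ?_)
    rw [norm_mul, norm_mul, RCLike.norm_conj, RCLike.norm_conj]
    ring
  rw [norm_mul, norm_pow, Complex.norm_real, Real.norm_of_nonneg ha.le]
  calc _ ≤ a m ^ J * (2 * ((|s - fixedPoint a m| ^ k * √|s - fixedPoint a m| * E) *
          (|s - fixedPoint a m| ^ (k + 1) * √|s - fixedPoint a m| * E))) := by
        refine mul_le_mul_of_nonneg_left (h1.trans ?_) (by positivity)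
        exact mul_le_mul_of_nonneg_left
          (mul_le_mul (hder s) (hval s) (norm_nonneg _) (by positivity)) zero_le_two
    _ = a m ^ J * (2 * (|s - fixedPoint a m| ^ (2 * k + 1) *
          (√|s - fixedPoint a m| * √|s - fixedPoint a m|) * E ^ 2)) := by ring
    _ = a m ^ J * (2 * (|s - fixedPoint a m| ^ (2 * k + 2) * E ^ 2)) := by
        rw [Real.mul_self_sqrt (abs_nonneg _)]
        ring
    _ ≤ a m ^ J * (2 * ((a m ^ J) ^ (2 * k + 2) * E ^ 2)) := by gcongr
    _ = _ := by
        rw [hpow]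
        ring

/-- Evaluation of the `i`-th derivative at `x`, `i < n`, on the energy space. -/
def evalCLM (n : ℕ) (hn : 1 < n) (i : ℕ) (x : ℝ) : energySpace n hn →L[ℂ] ℂ :=
  (iteratedPrimitiveCLM (n - 1 - i) x).comp (energySpace n hn).subtypeL

theorem evalCLM_apply (hn : 1 < n) {i : ℕ} (hi : i < n) (x : ℝ) (y : dirichletSobolev n) :
    evalCLM n hn i x (energyEquiv n hn y) = iteratedDeriv i (y : ℝ → ℂ) x := by
  change iteratedPrimitive (topDeriv n hn y) (n - 1 - i) x = _
  rw [iteratedPrimitive_topDeriv hn y (by omega)]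
  congr 1
  omega

/-- The vanishing conditions at the fixed point and at the first generations of jumps. -/
theorem exists_vanishing_conditions (hn : 1 < n) (a : ℕ → ℝ) (m : ℕ) (A : Finset ℕ) (J : ℕ) :
    ∃ L : energySpace n hn →L[ℂ] (Fin (J * A.card + n) → ℂ), ∀ y : dirichletSobolev n,
      L (energyEquiv n hn y) = 0 →
        (∀ i < n, iteratedDeriv i (y : ℝ → ℂ) (fixedPoint a m) = 0) ∧
        ∀ j < J, ∀ k ∈ A, (y : ℝ → ℂ) ((contraction a m)^[j] (knot a k)) = 0 := by
  let e : (Fin J × A) ⊕ Fin n ≃ Fin (J * A.card + n) := Fintype.equivFinOfCardEq (by simp)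
  let c : (Fin J × A) ⊕ Fin n → energySpace n hn →L[ℂ] ℂ := Sum.elim
    (fun p => evalCLM n hn 0 ((contraction a m)^[p.1] (knot a p.2)))
    (fun i => evalCLM n hn i (fixedPoint a m))
  refine ⟨ContinuousLinearMap.pi fun r => c (e.symm r), fun y hy => ?_⟩
  have h : ∀ p, c p (energyEquiv n hn y) = 0 := fun p => by
    simpa using congrFun hy (e p)
  refine ⟨fun i hi => ?_, fun j hj k hk => ?_⟩
  · rw [← evalCLM_apply hn hi]
    exact h (Sum.inr ⟨i, hi⟩)
  · rw [← iteratedDeriv_zero (f := (y : ℝ → ℂ)), ← evalCLM_apply hn (by omega)]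
    exact h (Sum.inl (⟨j, hj⟩, ⟨k, hk⟩))

theorem IsZeroSpectralOrder.norm_pow_mul_remainder_le (hP : IsZeroSpectralOrder N m a β d P)
    (hn : 1 < n) (hd : 0 < d m) (y : dirichletSobolev n)
    (hy : ∀ i < n, iteratedDeriv i (y : ℝ → ℂ) (fixedPoint a m) = 0) (J : ℕ) :
    ‖(d m : ℂ) ^ J * boundaryFunctional N β P
        ((fun t => (y : ℝ → ℂ) t * conj ((y : ℝ → ℂ) t)) ∘ (contraction a m)^[J])‖ ≤
      (2 * boundaryConst N β P + 1) * (a m ^ (2 * n - 1) * d m) ^ J * ‖topDeriv n hn y‖ ^ 2 := by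
  have ha := hP.length_pos
  rw [norm_mul, norm_pow, Complex.norm_real, Real.norm_of_nonneg hd.le]
  refine (mul_le_mul_of_nonneg_left (hP.norm_remainder_le hn y hy J) (by positivity)).trans ?_
  rw [mul_pow]
  have : 0 ≤ (a m ^ (2 * n - 1)) ^ J * d m ^ J * ‖topDeriv n hn y‖ ^ 2 := by positivity
  linarith

theorem IsZeroSpectralOrder.re_weightForm_le (hP : IsZeroSpectralOrder N m a β d P)
    (hn : 1 < n) (hd : 0 < d m) (y : dirichletSobolev n)
    (hy : ∀ i < n, iteratedDeriv i (y : ℝ → ℂ) (fixedPoint a m) = 0) {J : ℕ}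
    (hJ : ∀ j < J, ∀ k ∈ (Finset.Icc 1 (N - 1)).filter fun k => 0 < zeta N m β d k,
      (y : ℝ → ℂ) ((contraction a m)^[j] (knot a k)) = 0) :
    (weightForm P y y).re ≤
      (2 * boundaryConst N β P + 1) * (a m ^ (2 * n - 1) * d m) ^ J * ‖topDeriv n hn y‖ ^ 2 := by
  rw [hP.weightForm_self_eq hn y.2 J, Complex.add_re, Complex.ofReal_re]
  have h1 := (Complex.re_le_norm _).trans (hP.norm_pow_mul_remainder_le hn hd y hy J)
  have h2 : ∑ j ∈ Finset.range J, d m ^ j * ∑ k ∈ Finset.Icc 1 (N - 1),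
      zeta N m β d k * ‖(y : ℝ → ℂ) ((contraction a m)^[j] (knot a k))‖ ^ 2 ≤ 0 := by
    refine Finset.sum_nonpos fun j hj => mul_nonpos_of_nonneg_of_nonpos (by positivity) ?_
    refine Finset.sum_nonpos fun k hk => ?_
    rcases lt_or_ge 0 (zeta N m β d k) with h | h
    · rw [hJ j (Finset.mem_range.1 hj) k (Finset.mem_filter.2 ⟨hk, h⟩)]
      simp
    · exact mul_nonpos_of_nonpos_of_nonneg h (sq_nonneg _)
  linarith

theorem IsZeroSpectralOrder.abs_re_weightForm_le (hP : IsZeroSpectralOrder N m a β d P)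
    (hn : 1 < n) (hd : 0 < d m) (y : dirichletSobolev n)
    (hy : ∀ i < n, iteratedDeriv i (y : ℝ → ℂ) (fixedPoint a m) = 0) {J : ℕ}
    (hJ : ∀ j < J, ∀ k ∈ Finset.Icc 1 (N - 1),
      (y : ℝ → ℂ) ((contraction a m)^[j] (knot a k)) = 0) :
    |(weightForm P y y).re| ≤
      (2 * boundaryConst N β P + 1) * (a m ^ (2 * n - 1) * d m) ^ J * ‖topDeriv n hn y‖ ^ 2 := by
  have h2 : ∑ j ∈ Finset.range J, d m ^ j * ∑ k ∈ Finset.Icc 1 (N - 1),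
      zeta N m β d k * ‖(y : ℝ → ℂ) ((contraction a m)^[j] (knot a k))‖ ^ 2 = 0 := by
    refine Finset.sum_eq_zero fun j hj => ?_
    rw [Finset.sum_eq_zero fun k hk => ?_, mul_zero]
    rw [hJ j (Finset.mem_range.1 hj) k hk]
    simp
  rw [hP.weightForm_self_eq hn y.2 J, h2, Complex.ofReal_zero, zero_add]
  exact (Complex.abs_re_le_norm _).trans (hP.norm_pow_mul_remainder_le hn hd y hy J)

theorem IsZeroSpectralOrder.isCompactOperator_weightOperator
    (hP : IsZeroSpectralOrder N m a β d P) (hn : 1 < n) (hd : 0 < d m) :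
    IsCompactOperator (weightOperator n hn P hP.memLp) := by
  refine isCompactOperator_of_small (weightOperator_isSymmetric hn hP.memLp) fun ε hε => ?_
  have hB : 0 < 2 * boundaryConst N β P + 1 := by linarith [boundaryConst_nonneg N β P]
  have hκ : 0 < a m ^ (2 * n - 1) * d m := mul_pos (pow_pos hP.length_pos _) hd
  obtain ⟨J, hJ⟩ := exists_pow_lt_of_lt_one (div_pos hε hB) (hP.ratio_lt_one hd hn)
  obtain ⟨L, hL⟩ := exists_vanishing_conditions hn a m (Finset.Icc 1 (N - 1)) J
  refine ⟨_, L, fun v hv => ?_⟩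
  obtain ⟨y, rfl⟩ := (energyEquiv n hn).surjective v
  rw [inner_weightOperator]
  refine (hP.abs_re_weightForm_le hn hd y (hL y hv).1 (hL y hv).2).trans ?_
  rw [norm_energyEquiv]
  gcongr
  rw [lt_div_iff₀ hB] at hJ
  linarith

theorem IsZeroSpectralOrder.finite_spectralSpan_weightOperator
    (hP : IsZeroSpectralOrder N m a β d P) (hn : 1 < n) (hd : 0 < d m) (J : ℕ) {lam : ℝ}
    (hlam : lam * ((2 * boundaryConst N β P + 1) * (a m ^ (2 * n - 1) * d m) ^ J) < 1) :
    FiniteDimensional ℂ (spectralSpan (weightOperator n hn P hP.memLp) (Ioc 0 lam)) ∧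
      spectralCount (weightOperator n hn P hP.memLp) lam ≤ J * zPlus N m β d + n := by
  rcases le_or_gt lam 0 with h0 | h0
  · rw [spectralCount_of_nonpos h0, Ioc_eq_empty_of_le h0]
    refine ⟨?_, Nat.zero_le _⟩
    have h' : spectralSpan (weightOperator n hn P hP.memLp) ∅ = ⊥ := by simp [spectralSpan]
    rw [h']
    infer_instance
  obtain ⟨L, hL⟩ := exists_vanishing_conditions hn a m
    ((Finset.Icc 1 (N - 1)).filter fun k => 0 < zeta N m β d k) J
  refine finite_spectralSpan (weightOperator_isSymmetric hn hP.memLp)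
    L.toLinearMap fun v hv hne => ?_
  obtain ⟨y, rfl⟩ := (energyEquiv n hn).surjective v
  rw [inner_weightOperator]
  refine (hP.re_weightForm_le hn hd y (hL y hv).1 (hL y hv).2).trans_lt ?_
  rw [← norm_energyEquiv]
  refine mul_lt_mul_of_pos_right ?_ (pow_pos (norm_pos_iff.2 hne) 2)
  rwa [lt_inv_comm₀ (mul_pos (by linarith [boundaryConst_nonneg N β P])
    (pow_pos (mul_pos (pow_pos hP.length_pos _) hd) J)) h0, ← one_div, lt_div_iff₀ (mul_pos
    (by linarith [boundaryConst_nonneg N β P]) (pow_pos (mul_pos (pow_pos hP.length_pos _) hd) J))]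

theorem IsZeroSpectralOrder.finiteDimensional_spectralSpan
    (hP : IsZeroSpectralOrder N m a β d P) (hn : 1 < n) (hd : 0 < d m) (lam : ℝ) :
    FiniteDimensional ℂ (spectralSpan (weightOperator n hn P hP.memLp) (Ioc 0 lam)) := by
  have hB : 0 < 2 * boundaryConst N β P + 1 := by linarith [boundaryConst_nonneg N β P]
  have hpos : 0 < (|lam| + 1) * (2 * boundaryConst N β P + 1) := by positivity
  obtain ⟨J, hJ⟩ := exists_pow_lt_of_lt_one (inv_pos.2 hpos) (hP.ratio_lt_one hd hn)
  refine (hP.finite_spectralSpan_weightOperator hn hd J (lam := lam) ?_).1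
  have hκ : 0 < (a m ^ (2 * n - 1) * d m) ^ J := pow_pos (mul_pos (pow_pos hP.length_pos _) hd) J
  rw [lt_inv_comm₀ hκ hpos, ← one_div, lt_div_iff₀ hκ] at hJ
  refine lt_of_le_of_lt ?_ hJ
  rw [← mul_assoc]
  gcongr
  linarith [le_abs_self lam]

end UpperBound

section Scaling

variable {n N m : ℕ} {a β d : ℕ → ℝ} {P : ℝ → ℝ}

theorem iteratedDeriv_comp_sub_div (f : ℝ → ℂ) (b c : ℝ) (k : ℕ) :
    iteratedDeriv k (fun x => f ((x - b) / c)) =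
      fun x => ((c⁻¹ ^ k : ℝ) : ℂ) * iteratedDeriv k f ((x - b) / c) := by
  induction k with
  | zero => simp
  | succ k ih =>
    funext x
    rw [iteratedDeriv_succ, ih, deriv_const_mul_field, iteratedDeriv_succ]
    have h : deriv (fun x => iteratedDeriv k f ((x - b) / c)) x =
        (c⁻¹ : ℝ) • deriv (iteratedDeriv k f) ((x - b) / c) := by
      have e : (fun x => iteratedDeriv k f ((x - b) / c)) =
          fun x => (fun s => iteratedDeriv k f (c⁻¹ * s)) (x - b) := by
        funext x
        rw [div_eq_inv_mul]
      rw [e, deriv_comp_sub_const (f := fun s => iteratedDeriv k f (c⁻¹ * s)),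
        deriv_comp_mul_left, div_eq_inv_mul]
    rw [h, Complex.real_smul, pow_succ]
    push_cast
    ring

theorem aestronglyMeasurable_iteratedDeriv (hn : 1 < n) (f : ℝ → ℂ) :
    AEStronglyMeasurable (iteratedDeriv n f) volume := by
  obtain ⟨k, rfl⟩ : ∃ k, n = k + 1 := ⟨n - 1, by omega⟩
  rw [iteratedDeriv_succ]
  exact aestronglyMeasurable_deriv _ _

/-- Transplantation of a function from `[0,1]` to the `m`-th interval of the partition. -/
def transplant (a : ℕ → ℝ) (m : ℕ) (u : ℝ → ℂ) (x : ℝ) : ℂ := u ((x - knot a (m - 1)) / a m)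

theorem IsZeroSpectralOrder.transplant_eq_zero (hP : IsZeroSpectralOrder N m a β d P) {u : ℝ → ℂ}
    (hu : u ∈ dirichletSobolev n) {x : ℝ} (hx : x ∉ Ioo (knot a (m - 1)) (knot a m)) :
    transplant a m u x = 0 := by
  refine hu.1 _ fun h => hx ?_
  have h0 := hP.length_pos
  rw [hP.knot_sub]
  exact ⟨by linarith [(div_pos_iff_of_pos_right h0).1 h.1], by linarith [(div_lt_one h0).1 h.2]⟩

theorem IsZeroSpectralOrder.memLp_iteratedDeriv_transplant (hP : IsZeroSpectralOrder N m a β d P)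
    (hn : 1 < n) {u : ℝ → ℂ} (hu : u ∈ dirichletSobolev n) :
    MemLp (iteratedDeriv n (transplant a m u)) 2 volume := by
  rw [memLp_two_iff_integrable_sq_norm (aestronglyMeasurable_iteratedDeriv hn _)]
  have h := (memLp_two_iff_integrable_sq_norm (aestronglyMeasurable_iteratedDeriv hn _)).1
    (memLp_iteratedDeriv hn hu)
  have h1 := ((h.comp_div hP.length_pos.ne').comp_sub_right (knot a (m - 1))).const_mul
    (‖(((a m)⁻¹ ^ n : ℝ) : ℂ)‖ ^ 2)
  refine h1.congr (Eventually.of_forall fun x => ?_)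
  change _ = ‖iteratedDeriv n (fun x => u ((x - knot a (m - 1)) / a m)) x‖ ^ 2
  rw [iteratedDeriv_comp_sub_div, norm_mul, mul_pow]

theorem IsZeroSpectralOrder.transplant_mem (hP : IsZeroSpectralOrder N m a β d P) (hn : 1 < n)
    {u : ℝ → ℂ} (hu : u ∈ dirichletSobolev n) : transplant a m u ∈ dirichletSobolev n := by
  have h0 := hP.length_pos
  have hm := Finset.mem_Icc.1 hP.mem
  have hb := hP.toIsSelfSimilar.knot_mem_Icc (show m - 1 ≤ N by omega)
  refine mem_dirichletSobolev_of_integral (fun x hx => hP.transplant_eq_zero hu fun h => hx ?_)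
    (hu.2.1.comp ((contDiff_id.sub contDiff_const).div_const _))
    (hP.memLp_iteratedDeriv_transplant hn hu) fun x => ?_
  · exact ⟨hb.1.trans_lt h.1, h.2.trans_le (hP.toIsSelfSimilar.knot_mem_Icc hm.2).2⟩
  · have hint := intervalIntegrable_of_memLp_two (memLp_iteratedDeriv hn hu)
    have hneg : ∫ t in (0 : ℝ)..0 / a m - knot a (m - 1) / a m, iteratedDeriv n u t = 0 := by
      rw [← iteratedDeriv_pred_eq_integral hn hu]
      refine iteratedDeriv_eq_zero_of_notMem_Ioo hu le_rfl fun h => ?_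
      have : 0 ≤ knot a (m - 1) / a m := div_nonneg hb.1 h0.le
      rw [zero_div, zero_sub] at h
      linarith [h.1]
    have h1 := intervalIntegral.integral_comp_div_sub (a := 0) (b := x) (iteratedDeriv n u) h0.ne'
      (knot a (m - 1) / a m)
    rw [← intervalIntegral.integral_interval_sub_left (hint 0 _) (hint 0 _), hneg, sub_zero,
      ← iteratedDeriv_pred_eq_integral hn hu, ← sub_div] at h1
    unfold transplant
    rw [iteratedDeriv_comp_sub_div, iteratedDeriv_comp_sub_div,
      intervalIntegral.integral_const_mul]
    simp only [sub_div] at h1 ⊢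
    rw [h1, Complex.real_smul, ← mul_assoc, ← Complex.ofReal_mul]
    congr 2
    obtain ⟨k, rfl⟩ : ∃ k, n = k + 1 := ⟨n - 1, by omega⟩
    rw [Nat.add_sub_cancel, pow_succ, mul_assoc, inv_mul_cancel₀ h0.ne', mul_one]

theorem norm_topDeriv_sq (hn : 1 < n) (y : dirichletSobolev n) :
    ‖topDeriv n hn y‖ ^ 2 = ∫ x, ‖iteratedDeriv n (y : ℝ → ℂ) x‖ ^ 2 := by
  have h : ((‖topDeriv n hn y‖ ^ 2 : ℝ) : ℂ) =
      ((∫ x, ‖iteratedDeriv n (y : ℝ → ℂ) x‖ ^ 2 : ℝ) : ℂ) := by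
    rw [← integral_complex_ofReal, Complex.ofReal_pow]
    refine (inner_self_eq_norm_sq_to_K (𝕜 := ℂ) (topDeriv n hn y)).symm.trans ?_
    rw [L2.inner_def]
    refine integral_congr_ae ?_
    filter_upwards [coeFn_topDeriv hn y] with x hx
    rw [hx, inner_self_eq_norm_sq_to_K, Complex.ofReal_pow]
    rfl
  exact_mod_cast h

/-- `transplant` as a linear map on `W̊₂ⁿ[0,1]`. -/
def IsZeroSpectralOrder.transplantₗ (hP : IsZeroSpectralOrder N m a β d P) (hn : 1 < n) :
    dirichletSobolev n →ₗ[ℂ] dirichletSobolev n where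
  toFun u := ⟨transplant a m u, hP.transplant_mem hn u.2⟩
  map_add' _ _ := rfl
  map_smul' _ _ := rfl

theorem IsZeroSpectralOrder.norm_transplant_sq (hP : IsZeroSpectralOrder N m a β d P)
    (hn : 1 < n) (u : dirichletSobolev n) :
    a m ^ (2 * n - 1) * ‖topDeriv n hn (hP.transplantₗ hn u)‖ ^ 2 = ‖topDeriv n hn u‖ ^ 2 := by
  have h0 := hP.length_pos
  rw [norm_topDeriv_sq, norm_topDeriv_sq]
  have e : ∀ x, ‖iteratedDeriv n (hP.transplantₗ hn u : ℝ → ℂ) x‖ ^ 2 =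
      ((a m)⁻¹ ^ n) ^ 2 *
        ‖iteratedDeriv n (u : ℝ → ℂ) ((x - knot a (m - 1)) / a m)‖ ^ 2 := by
    intro x
    change ‖iteratedDeriv n (fun x => (u : ℝ → ℂ) ((x - knot a (m - 1)) / a m)) x‖ ^ 2 = _
    rw [iteratedDeriv_comp_sub_div, norm_mul, Complex.norm_real, Real.norm_of_nonneg (by positivity),
      mul_pow]
  simp only [e]
  rw [integral_const_mul, integral_sub_right_eq_self
    (fun x => ‖iteratedDeriv n (u : ℝ → ℂ) (x / a m)‖ ^ 2) (knot a (m - 1)),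
    Measure.integral_comp_div (fun x => ‖iteratedDeriv n (u : ℝ → ℂ) x‖ ^ 2) (a m),
    abs_of_pos h0, smul_eq_mul, ← mul_assoc, ← mul_assoc]
  rw [show a m ^ (2 * n - 1) * ((a m)⁻¹ ^ n) ^ 2 * a m = 1 from ?_, one_mul]
  rw [mul_right_comm, ← pow_succ, show 2 * n - 1 + 1 = n * 2 by omega, ← pow_mul, ← mul_pow,
    mul_inv_cancel₀ h0.ne', one_pow]

theorem boundaryFunctional_congr {f g : ℝ → ℂ} (h : ∀ x ∈ Icc (0 : ℝ) 1, f x = g x) :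
    boundaryFunctional N β P f = boundaryFunctional N β P g := by
  unfold boundaryFunctional
  rw [h 0 (left_mem_Icc.2 zero_le_one), h 1 (right_mem_Icc.2 zero_le_one)]
  congr 3
  refine intervalIntegral.integral_congr_ae ?_
  filter_upwards [measure_eq_zero_iff_ae_notMem.1 (measure_singleton (1 : ℝ))] with x h1 hx
  rw [uIoc_of_le zero_le_one] at hx
  have : f =ᶠ[𝓝 x] g := by
    filter_upwards [isOpen_Ioo.mem_nhds (show x ∈ Ioo (0 : ℝ) 1 from
      ⟨hx.1, lt_of_le_of_ne hx.2 h1⟩)] with t ht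
    exact h t (Ioo_subset_Icc_self ht)
  rw [this.deriv_eq]

theorem IsZeroSpectralOrder.knot_notMem (hP : IsZeroSpectralOrder N m a β d P) {k : ℕ}
    (hk : k ≤ N) : knot a k ∉ Ioo (knot a (m - 1)) (knot a m) := by
  have hm := Finset.mem_Icc.1 hP.mem
  intro h
  rcases le_or_gt m k with h1 | h1
  · exact (hP.toIsSelfSimilar.knot_le h1 hk).not_gt h.2
  · exact (hP.toIsSelfSimilar.knot_le (show k ≤ m - 1 by omega) (by omega)).not_gt h.1

theorem IsZeroSpectralOrder.transplant_contraction (hP : IsZeroSpectralOrder N m a β d P)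
    (u : ℝ → ℂ) (t : ℝ) : transplant a m u (contraction a m t) = u t := by
  rw [transplant, contraction, add_sub_cancel_left, mul_div_cancel_left₀ _ hP.length_pos.ne']

/-- The quadratic form of the weight on the sum of a transplanted function and a function which
vanishes at the jumps of the second generation and on the second iterate of the interval. -/
theorem IsZeroSpectralOrder.weightForm_transplant_add (hP : IsZeroSpectralOrder N m a β d P)
    (hn : 1 < n) {u φ : ℝ → ℂ} (hu : u ∈ dirichletSobolev n) (hφ : φ ∈ dirichletSobolev n)
    (h1 : ∀ k ∈ Finset.Icc 1 (N - 1), φ (contraction a m (knot a k)) = 0)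
    (h2 : ∀ t ∈ Icc (0 : ℝ) 1, φ (contraction a m (contraction a m t)) = 0) :
    weightForm P (transplant a m u + φ) (transplant a m u + φ) = d m * weightForm P u u +
      ((∑ k ∈ Finset.Icc 1 (N - 1), zeta N m β d k * ‖φ (knot a k)‖ ^ 2 : ℝ) : ℂ) := by
  have hR := hP.transplant_mem hn hu
  have hy := add_mem hR hφ
  set f : ℝ → ℂ := fun t => (transplant a m u + φ) t * conj ((transplant a m u + φ) t) with hf
  set g : ℝ → ℂ := fun t => transplant a m u t * conj (transplant a m u t) with hg
  have hfc : ContDiff ℝ 1 f := contDiff_mul_conj hn hy hy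
  have hgc : ContDiff ℝ 1 g := contDiff_mul_conj hn hR hR
  have hzero : ∀ {y : ℝ → ℂ}, y ∈ dirichletSobolev n → y 0 * conj (y 0) = 0 := fun hy => by
    rw [hy.1 0 fun h => h.1.false, zero_mul]
  have hone : ∀ {y : ℝ → ℂ}, y ∈ dirichletSobolev n → y 1 * conj (y 1) = 0 := fun hy => by
    rw [hy.1 1 fun h => h.2.false, zero_mul]
  have hc0 : m = 1 → contraction a m 0 = 0 := fun h => iterate_contraction_zero h 1
  have hc1 : m = N → contraction a m 1 = 1 := fun h => hP.iterate_contraction_one h 1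
  have hfg : boundaryFunctional N β P (f ∘ contraction a m) =
      boundaryFunctional N β P (g ∘ contraction a m) := by
    rw [hP.boundaryFunctional_eq (hfc.comp (contDiff_contraction a m))
        (fun h => by rw [Function.comp_apply, hc0 h]; exact hzero hy)
        (fun h => by rw [Function.comp_apply, hc1 h]; exact hone hy),
      hP.boundaryFunctional_eq (hgc.comp (contDiff_contraction a m))
        (fun h => by rw [Function.comp_apply, hc0 h]; exact hzero hR)
        (fun h => by rw [Function.comp_apply, hc1 h]; exact hone hR)]
    congr 1
    · refine Finset.sum_congr rfl fun k hk => ?_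
      simp only [hf, hg, Function.comp_apply, Pi.add_apply, h1 k hk, add_zero]
    · congr 1
      refine boundaryFunctional_congr fun t ht => ?_
      simp only [hf, hg, Function.comp_apply, Pi.add_apply, h2 t ht, add_zero]
  have hgu : g ∘ contraction a m = fun t => u t * conj (u t) := by
    funext t
    simp only [hg, Function.comp_apply, hP.transplant_contraction]
  rw [weightForm_eq_boundaryFunctional N β hy, weightForm_eq_boundaryFunctional N β hu,
    hP.boundaryFunctional_eq hfc (fun _ => hzero hy) (fun _ => hone hy), hfg, hgu, add_comm]
  congr 1
  push_cast
  refine Finset.sum_congr rfl fun k hk => ?_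
  have hkN : k ≤ N := by
    have := Finset.mem_Icc.1 hk
    omega
  simp only [hf, Pi.add_apply, hP.transplant_eq_zero hu (hP.knot_notMem hkN), zero_add,
    Complex.mul_conj']

end Scaling

section Bumps

variable {n N m : ℕ} {a β d : ℕ → ℝ} {P : ℝ → ℝ}

theorem exists_bump (n : ℕ) {F : Set ℝ} (hF : IsClosed F) (h01 : (Ioo (0 : ℝ) 1)ᶜ ⊆ F) {x : ℝ}
    (hx : x ∉ F) : ∃ φ ∈ dirichletSobolev n, φ x = 1 ∧ ∀ t ∈ F, φ t = 0 := by
  obtain ⟨f, hsupp, -, hsmooth, -, hfx⟩ := exists_contDiff_tsupport_subset (n := (n + 1 : ℕ))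
    (hF.isOpen_compl.mem_nhds hx)
  have hzero : ∀ t ∈ F, f t = 0 := fun t ht =>
    image_eq_zero_of_notMem_tsupport fun h => hsupp h ht
  have hc : ContDiff ℝ (n + 1 : ℕ) (fun t => (f t : ℂ)) := Complex.ofRealCLM.contDiff.comp hsmooth
  refine ⟨fun t => f t, ?_, by simp [hfx], fun t ht => by simp [hzero t ht]⟩
  have hev : (fun t => (f t : ℂ)) =ᶠ[𝓝 0] fun _ => 0 := by
    have h : (0 : ℝ) ∉ tsupport f := fun h => hsupp h (h01 fun h' => h'.1.false)
    filter_upwards [notMem_tsupport_iff_eventuallyEq.1 h] with t ht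
    simp [ht]
  refine ⟨fun t ht => by simp [hzero t (h01 ht)], hc.of_le (by exact_mod_cast (by omega)), ?_⟩
  have hcont : Continuous (deriv (iteratedDeriv (n - 1) fun t => (f t : ℂ))) := by
    rw [← iteratedDeriv_succ]
    exact hc.continuous_iteratedDeriv _ (by exact_mod_cast (by omega))
  refine ⟨deriv (iteratedDeriv (n - 1) fun t => (f t : ℂ)), ?_, fun t _ => ?_⟩
  · obtain ⟨C, hC⟩ := (isCompact_Icc (a := (0 : ℝ)) (b := 1)).exists_bound_of_continuousOn
      hcont.continuousOn
    exact MemLp.of_bound hcont.aestronglyMeasurable C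
      ((ae_restrict_iff' measurableSet_Icc).2 (Eventually.of_forall hC))
  · have hd : Differentiable ℝ (iteratedDeriv (n - 1) fun t => (f t : ℂ)) :=
      hc.differentiable_iteratedDeriv _ (by exact_mod_cast (by omega))
    rw [intervalIntegral.integral_deriv_eq_sub (fun s _ => hd s) (hcont.intervalIntegrable _ _),
      hev.iteratedDeriv_eq]
    simp

/-- Functions which separate the jumps of the first generation and vanish at the jumps of the
second generation and on the second iterate of the interval. -/
theorem IsZeroSpectralOrder.exists_bump_knot (hP : IsZeroSpectralOrder N m a β d P) (n : ℕ)
    {k : ℕ} (hk : k ∈ Finset.Icc 1 (N - 1)) :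
    ∃ φ ∈ dirichletSobolev n, φ (knot a k) = 1 ∧
      (∀ i ∈ Finset.Icc 1 (N - 1), i ≠ k → φ (knot a i) = 0) ∧
      (∀ i ∈ Finset.Icc 1 (N - 1), φ (contraction a m (knot a i)) = 0) ∧
      ∀ t ∈ Icc (0 : ℝ) 1, φ (contraction a m (contraction a m t)) = 0 := by
  have hS := hP.toIsSelfSimilar
  have hm := Finset.mem_Icc.1 hP.mem
  have ha := hP.length_pos
  have hk' := Finset.mem_Icc.1 hk
  have hN := hP.one_lt
  have hcont : Continuous (contraction a m) := (contDiff_contraction a m (r := 0)).continuous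
  set F : Set ℝ := (Ioo (0 : ℝ) 1)ᶜ ∪ (knot a '' ((Finset.Icc 1 (N - 1)).erase k : Finset ℕ) ∪
    ((fun i => contraction a m (knot a i)) '' (Finset.Icc 1 (N - 1) : Finset ℕ) ∪
      (fun t => contraction a m (contraction a m t)) '' Icc (0 : ℝ) 1)) with hF
  have hcl : IsClosed F := by
    refine isOpen_Ioo.isClosed_compl.union (IsClosed.union ?_ (IsClosed.union ?_ ?_))
    · exact ((Finset.finite_toSet _).image _).isClosed
    · exact ((Finset.finite_toSet _).image _).isClosed
    · exact (isCompact_Icc.image (hcont.comp hcont)).isClosed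
  have hx : knot a k ∉ F := by
    rintro (h | ⟨i, hi, h⟩ | ⟨i, hi, h⟩ | ⟨t, ht, h⟩)
    · exact h (hS.knot_mem_Ioo hk)
    · rw [Finset.mem_coe, Finset.mem_erase, Finset.mem_Icc] at hi
      rcases lt_or_gt_of_ne hi.1 with h' | h'
      · exact (hS.knot_lt h' (by omega)).ne h
      · exact (hS.knot_lt h' (by omega)).ne' h
    · have hi' := hS.knot_mem_Ioo hi
      refine hP.knot_notMem (k := k) (by omega) (h ▸ ?_)
      rw [hP.knot_sub]
      dsimp only
      constructor <;> unfold contraction <;> nlinarith [hi'.1, hi'.2]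
    · dsimp only at h
      have hs := hP.contraction_mem_Icc ht
      set s := contraction a m t
      rw [contraction] at h
      rcases le_or_gt m k with hmk | hmk
      · have h1 := hS.knot_le hmk (by omega)
        have h2 := hS.knot_lt (show m < N by omega) le_rfl
        rw [hS.knot_top] at h2
        rw [hP.knot_sub] at h1
        nlinarith [hs.2]
      · have h1 := hS.knot_le (show k ≤ m - 1 by omega) (by omega)
        have h2 := hS.knot_lt (show 0 < m - 1 by omega) (by omega)
        rw [knot_zero] at h2
        nlinarith [hs.1]
  obtain ⟨φ, hφ, h1, h0⟩ := exists_bump n hcl subset_union_left hx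
  refine ⟨φ, hφ, h1, fun i hi hik => h0 _ ?_, fun i hi => h0 _ ?_, fun t ht => h0 _ ?_⟩
  · exact Or.inr (Or.inl ⟨i, Finset.mem_coe.2 (Finset.mem_erase.2 ⟨hik, hi⟩), rfl⟩)
  · exact Or.inr (Or.inr (Or.inl ⟨i, Finset.mem_coe.2 hi, rfl⟩))
  · exact Or.inr (Or.inr (Or.inr ⟨t, ht, rfl⟩))

end Bumps

section LowerBound

variable {n N m : ℕ} {a β d : ℕ → ℝ} {P : ℝ → ℝ}

/-- The indices of the positive jumps of the first generation. -/
def positiveJumps (N m : ℕ) (β d : ℕ → ℝ) : Finset ℕ :=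
  (Finset.Icc 1 (N - 1)).filter fun k => 0 < zeta N m β d k

theorem card_positiveJumps (N m : ℕ) (β d : ℕ → ℝ) :
    (positiveJumps N m β d).card = zPlus N m β d := rfl

theorem IsZeroSpectralOrder.weightForm_transplant_add_sum
    (hP : IsZeroSpectralOrder N m a β d P) (hn : 1 < n) {φ : ℕ → dirichletSobolev n}
    (h1 : ∀ k ∈ Finset.Icc 1 (N - 1), (φ k : ℝ → ℂ) (knot a k) = 1)
    (h0 : ∀ k ∈ Finset.Icc 1 (N - 1), ∀ i ∈ Finset.Icc 1 (N - 1), i ≠ k →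
      (φ k : ℝ → ℂ) (knot a i) = 0)
    (h2 : ∀ k ∈ Finset.Icc 1 (N - 1), ∀ i ∈ Finset.Icc 1 (N - 1),
      (φ k : ℝ → ℂ) (contraction a m (knot a i)) = 0)
    (h3 : ∀ k ∈ Finset.Icc 1 (N - 1), ∀ t ∈ Icc (0 : ℝ) 1,
      (φ k : ℝ → ℂ) (contraction a m (contraction a m t)) = 0)
    (u : dirichletSobolev n) (c : positiveJumps N m β d → ℂ) :
    (weightForm P (hP.transplantₗ hn u + ∑ k, c k • φ k : dirichletSobolev n)
      (hP.transplantₗ hn u + ∑ k, c k • φ k : dirichletSobolev n)).re =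
      d m * (weightForm P u u).re +
        ∑ k : positiveJumps N m β d, zeta N m β d k * ‖c k‖ ^ 2 := by
  have hmem : ∀ k : positiveJumps N m β d, (k : ℕ) ∈ Finset.Icc 1 (N - 1) := fun k =>
    (Finset.mem_filter.1 k.2).1
  have heval : ∀ x, ((∑ k, c k • φ k : dirichletSobolev n) : ℝ → ℂ) x =
      ∑ k, c k * (φ k : ℝ → ℂ) x := by
    intro x
    simp [Finset.sum_apply]
  have hsum : ∑ k ∈ Finset.Icc 1 (N - 1), zeta N m β d k *
      ‖((∑ k, c k • φ k : dirichletSobolev n) : ℝ → ℂ) (knot a k)‖ ^ 2 =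
      ∑ k : positiveJumps N m β d, zeta N m β d k * ‖c k‖ ^ 2 := by
    have hsub : positiveJumps N m β d ⊆ Finset.Icc 1 (N - 1) := Finset.filter_subset _ _
    rw [← Finset.sum_subset hsub fun i hi hni => ?_, ← Finset.sum_coe_sort]
    · refine Finset.sum_congr rfl fun i _ => ?_
      rw [heval, Finset.sum_eq_single_of_mem i (Finset.mem_univ _) fun k _ hk => ?_,
        h1 i (hmem i), mul_one]
      rw [h0 k (hmem k) i (hmem i) fun h => hk (Subtype.ext h.symm), mul_zero]
    · rw [heval, Finset.sum_eq_zero fun k _ => ?_]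
      · simp
      · rw [h0 k (hmem k) i hi fun h => hni (h ▸ k.2), mul_zero]
  have key := hP.weightForm_transplant_add hn u.2 (∑ k, c k • φ k : dirichletSobolev n).2
    (fun i hi => by
      rw [heval]
      exact Finset.sum_eq_zero fun k _ => by rw [h2 k (hmem k) i hi, mul_zero])
    (fun t ht => by
      rw [heval]
      exact Finset.sum_eq_zero fun k _ => by rw [h3 k (hmem k) t ht, mul_zero])
  rw [hsum] at key
  change (weightForm P (transplant a m u + ((∑ k, c k • φ k : dirichletSobolev n) : ℝ → ℂ))
    (transplant a m u + ((∑ k, c k • φ k : dirichletSobolev n) : ℝ → ℂ))).re = _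
  rw [key, Complex.add_re, Complex.ofReal_re, Complex.re_ofReal_mul]

theorem norm_sum_smul_sq_le {E ι : Type*} [SeminormedAddCommGroup E] [NormedSpace ℂ E] [Fintype ι]
    {ζ : ι → ℝ} (hζ : ∀ i, 0 < ζ i) (φ : ι → E) (c : ι → ℂ) :
    ‖∑ i, c i • φ i‖ ^ 2 ≤ (∑ i, ‖φ i‖ ^ 2 / ζ i) * ∑ i, ζ i * ‖c i‖ ^ 2 := by
  have h1 : ‖∑ i, c i • φ i‖ ≤ ∑ i, ‖c i‖ * ‖φ i‖ :=
    (norm_sum_le _ _).trans (le_of_eq (Finset.sum_congr rfl fun i _ => norm_smul _ _))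
  refine (pow_le_pow_left₀ (norm_nonneg _) h1 2).trans ?_
  refine Finset.sum_sq_le_sum_mul_sum_of_sq_le_mul _ (fun i _ => ?_) (fun i _ => ?_) fun i _ => ?_
  · exact div_nonneg (sq_nonneg _) (hζ i).le
  · exact mul_nonneg (hζ i).le (sq_nonneg _)
  · have := (hζ i).ne'
    refine le_of_eq ?_
    field_simp

theorem add_sq_lt_of_bounds {lam C X Y p W : ℝ} (hY : 0 ≤ Y) (hC : 1 ≤ C)
    (hlam : C < lam) (hp : X ^ 2 / (lam - C) ≤ p) (hYW : Y ^ 2 ≤ (C - 1) * W) (hW : 0 ≤ W)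
    (hpos : 0 < X ∨ 0 < W) : lam⁻¹ * (X + Y) ^ 2 < p + W := by
  have hlC : 0 < lam - C := by linarith
  have hC0 : 0 < C := by linarith
  have hl : 0 < lam := by linarith
  have hcs : lam⁻¹ * (X + Y) ^ 2 ≤ X ^ 2 / (lam - C) + Y ^ 2 / C := by
    rw [inv_mul_le_iff₀ hl, ← sub_nonneg]
    have : lam * (X ^ 2 / (lam - C) + Y ^ 2 / C) - (X + Y) ^ 2 =
        (C * X - (lam - C) * Y) ^ 2 / ((lam - C) * C) := by
      field_simp
      ring
    rw [this]
    positivity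
  rcases hW.eq_or_lt with h0 | h0
  · rw [← h0, mul_zero] at hYW
    have hY0 : Y = 0 := by nlinarith
    have hX0 : 0 < X := hpos.resolve_right (by rw [← h0]; exact lt_irrefl _)
    subst hY0
    rw [← h0, add_zero, add_zero]
    refine lt_of_lt_of_le ?_ hp
    rw [div_eq_inv_mul]
    refine mul_lt_mul_of_pos_right ?_ (by positivity)
    exact inv_strictAnti₀ hlC (by linarith)
  · have hlt : Y ^ 2 / C < W := by
      rw [div_lt_iff₀ hC0]
      nlinarith
    linarith

theorem IsZeroSpectralOrder.exists_spectralCount_lower (hP : IsZeroSpectralOrder N m a β d P)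
    (hn : 1 < n) (hd : 0 < d m) : ∃ C : ℝ, 0 ≤ C ∧ ∀ lam, C < lam →
      spectralCount (weightOperator n hn P hP.memLp) (a m ^ (2 * n - 1) * d m * (lam - C)) +
        zPlus N m β d ≤ spectralCount (weightOperator n hn P hP.memLp) lam := by
  have ha := hP.length_pos
  set K := weightOperator n hn P hP.memLp
  have hsym := weightOperator_isSymmetric hn hP.memLp
  choose! φ' hφmem h1 h0 h2 h3 using fun k hk => hP.exists_bump_knot n (k := k) hk
  let φ : ℕ → dirichletSobolev n := fun k =>
    if hk : k ∈ Finset.Icc 1 (N - 1) then ⟨φ' k, hφmem k hk⟩ else 0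
  have hφ : ∀ k ∈ Finset.Icc 1 (N - 1), (φ k : ℝ → ℂ) = φ' k := fun k hk => by
    simp only [φ, dif_pos hk]
  set C₀ : ℝ := ∑ k : positiveJumps N m β d, ‖topDeriv n hn (φ k)‖ ^ 2 / zeta N m β d k
  have hζ : ∀ k : positiveJumps N m β d, 0 < zeta N m β d k := fun k =>
    (Finset.mem_filter.1 k.2).2
  have hC₀0 : 0 ≤ C₀ := Finset.sum_nonneg fun k _ => div_nonneg (sq_nonneg _) (hζ k).le
  refine ⟨C₀ + 1, by linarith, fun lam hlam => ?_⟩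
  set κ := a m ^ (2 * n - 1) * d m with hκ
  have hκ0 : 0 < κ := mul_pos (pow_pos ha _) hd
  have hlC : 0 < lam - (C₀ + 1) := by linarith
  have hl : 0 < lam := by linarith
  set V := spectralSpan K (Ioc 0 (κ * (lam - (C₀ + 1))))
  have hfin := hP.finiteDimensional_spectralSpan hn hd
  have := hfin lam
  have : FiniteDimensional ℂ V := hfin _
  let R : dirichletSobolev n →ₗ[ℂ] dirichletSobolev n := hP.transplantₗ hn
  let f : (V × (positiveJumps N m β d → ℂ)) →ₗ[ℂ] energySpace n hn :=
    (energyEquiv n hn : dirichletSobolev n →ₗ[ℂ] energySpace n hn).comp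
      (LinearMap.coprod (R.comp (((energyEquiv n hn).symm :
        energySpace n hn →ₗ[ℂ] dirichletSobolev n).comp V.subtype))
        (Fintype.linearCombination ℂ fun k : positiveJumps N m β d => φ k))
  have hrank : Module.finrank ℂ (V × (positiveJumps N m β d → ℂ)) =
      spectralCount K (κ * (lam - (C₀ + 1))) + zPlus N m β d := by
    rw [Module.finrank_prod, Module.finrank_fintype_fun_eq_card, Fintype.card_coe,
      card_positiveJumps]
    rfl
  rw [← hrank]
  refine finrank_le_spectralSpan hsym (hP.isCompactOperator_weightOperator hn hd) hl f ?_
  rintro ⟨⟨v, hv⟩, c⟩ hne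
  obtain ⟨u, rfl⟩ := (energyEquiv n hn).surjective v
  have hf : f (⟨energyEquiv n hn u, hv⟩, c) = energyEquiv n hn (R u + ∑ k, c k • φ k) := by
    simp [f, Fintype.linearCombination_apply]
  have hq : (κ * (lam - (C₀ + 1)))⁻¹ * ‖topDeriv n hn u‖ ^ 2 ≤ (weightForm P u u).re := by
    have h := le_re_inner_of_mem_spectralSpan hsym (s := Ioc 0 (κ * (lam - (C₀ + 1))))
      (fun μ hμ => inv_anti₀ hμ.1 hμ.2) hv
    rwa [inner_weightOperator, norm_energyEquiv] at h
  have hRu := hP.norm_transplant_sq hn u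
  rw [hf, inner_weightOperator, hP.weightForm_transplant_add_sum hn (φ := φ)
    (fun k hk => by rw [hφ k hk]; exact h1 k hk)
    (fun k hk => by rw [hφ k hk]; exact h0 k hk)
    (fun k hk => by rw [hφ k hk]; exact h2 k hk)
    (fun k hk => by rw [hφ k hk]; exact h3 k hk)]
  have hnorm : ‖energyEquiv n hn (R u + ∑ k, c k • φ k)‖ ≤
      ‖topDeriv n hn (R u)‖ + ‖∑ k, c k • topDeriv n hn (φ k)‖ := by
    rw [norm_energyEquiv, map_add, map_sum]
    simp only [map_smul]
    exact norm_add_le _ _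
  refine lt_of_le_of_lt (mul_le_mul_of_nonneg_left
    (pow_le_pow_left₀ (norm_nonneg _) hnorm 2) (inv_nonneg.2 hl.le)) ?_
  refine add_sq_lt_of_bounds (norm_nonneg _) (C := C₀ + 1) (by linarith) hlam
    ?_ ?_ (Finset.sum_nonneg fun k _ => mul_nonneg (hζ k).le (sq_nonneg _)) ?_
  · refine le_trans (le_of_eq ?_) (mul_le_mul_of_nonneg_left hq hd.le)
    rw [← hRu, hκ]
    have := hlC.ne'
    have := hd.ne'
    have := ha.ne'
    field_simp
    rfl
  · rw [add_sub_cancel_right]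
    exact norm_sum_smul_sq_le hζ (fun k => topDeriv n hn (φ k)) c
  · by_cases hc : c = 0
    · refine Or.inl (norm_pos_iff.2 fun h => hne ?_)
      have hu : ‖topDeriv n hn u‖ ^ 2 = 0 := by
        rw [← hRu]
        change _ * ‖topDeriv n hn (R u)‖ ^ 2 = 0
        rw [h]
        simp
      have hu' : energyEquiv n hn u = 0 := by
        rw [← norm_eq_zero, norm_energyEquiv]
        exact pow_eq_zero_iff two_ne_zero |>.1 hu
      rw [Prod.mk_eq_zero]
      exact ⟨Subtype.ext hu', hc⟩
    · right
      obtain ⟨k, hk⟩ := Function.ne_iff.1 hc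
      exact Finset.sum_pos' (fun k _ => mul_nonneg (hζ k).le (sq_nonneg _))
        ⟨k, Finset.mem_univ _, mul_pos (hζ k) (pow_pos (norm_pos_iff.2 hk) 2)⟩

end LowerBound

end SelfSimilarWeight

end

theorem mainTheorem1 (n N m : ℕ) (hn : 1 < n) (a β d : ℕ → ℝ) (P : ℝ → ℝ)
    (hP : SelfSimilarWeight.IsZeroSpectralOrder N m a β d P)
    (hd : 0 < d m)
    (hZ : 0 < SelfSimilarWeight.zPlus N m β d)
    (hZZ : SelfSimilarWeight.zPlus N m β d + SelfSimilarWeight.zMinus N m β d = N - 1) :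
    ∃ lam : ℕ → ℝ, SelfSimilarWeight.IsPositiveEigenvalueSequence n hn P hP.memLp lam ∧
      ∃ τ : ℕ → ℝ, ∀ l ∈ Finset.Icc 1 (SelfSimilarWeight.zPlus N m β d),
        0 < τ l ∧
        (fun k : ℕ => lam (l + k * SelfSimilarWeight.zPlus N m β d))
          ~[atTop] fun k : ℕ => τ l * ((a m ^ (2 * n - 1) * d m) ^ k)⁻¹ := by
  open SelfSimilarWeight in
  obtain ⟨C, hC, hlower⟩ := hP.exists_spectralCount_lower hn hd
  have hfin := hP.finiteDimensional_spectralSpan hn hd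
  obtain ⟨lam, hpos, hmono, hmult, τ, hτ⟩ := exists_enumeration_asymptotics
    (weightOperator_isSymmetric hn hP.memLp) hfin
    (mul_pos (pow_pos hP.length_pos (2 * n - 1)) hd) (hP.ratio_lt_one hd hn) hZ hC
    (B := 2 * boundaryConst N β P + 1) (by linarith [boundaryConst_nonneg N β P]) hlower
    (fun J lam hlam => (hP.finite_spectralSpan_weightOperator hn hd J hlam).2)
  refine ⟨lam, ⟨hpos, hmono, fun μ hμ => ?_, fun μ hμ => (hmult μ hμ).1, fun μ hμ => ?_⟩, τ,
    fun l hl => hτ l (Finset.mem_Icc.1 hl).1⟩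
  · have := hfin μ
    have hle : Module.End.eigenspace (weightOperator n hn P hP.memLp :
        energySpace n hn →ₗ[ℂ] energySpace n hn) (μ : ℂ)⁻¹ ≤
        spectralSpan (weightOperator n hn P hP.memLp) (Ioc 0 μ) := by
      rw [← spectralSpan_singleton]
      exact spectralSpan_mono _ (singleton_subset_iff.2 ⟨hμ, le_rfl⟩)
    have := Submodule.finiteDimensional_of_le hle
    exact (eigenspaceEquiv hn hP.memLp hμ).finiteDimensional
  · rw [(hmult μ hμ).2]
    exact (eigenspaceEquiv hn hP.memLp hμ).finrank_eq
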